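/- Cubes $Q\subset\mathbb R^d$ ($d\ge 1$) have sides parallel to the axes, $\langle f\rangle_Q=\frac1{|Q|}\int_Q f\,dx$, and a weight is a measurable function $w$ with $0<w<\infty$ a.e. Write $u\in A_1$ if $u$ is a locally integrable weight with $\sup_Q\langle u\rangle_Q\operatorname{ess\,sup}_Q u^{-1}<\infty$. For $1\le p<\infty$ and $0<t<\infty$, a weight $w$ belongs to $A^u_{p,t}$ if $$[w]_{A^u_{p,t}}:=\sup_Q\ \big\langle (uw)^{t}\big\rangle_Q^{1/t}\,\big\langle w^{-p'}\big\rangle_Q^{1/p'}\,\langle u^{-1}\rangle_Q<\infty ,\qquad \tfrac1p+\tfrac1{p'}=1,$$ where for $p=1$ the factor $\langle w^{-p'}\rangle_Q^{1/p'}$ is replaced by $\operatorname{ess\,sup}_Q w^{-1}$. **Theorem 1.3.** Let $u\in A_1$, $1\le p_0<\infty$, $0<q_0,t_0<\infty$, and let $\mathcal F$ be a collection of pairs $(g,f)$ of non-negative measurable functions on $\mathbb R^d$. Assume that for every $w\in A^u_{p_0,t_0}$ there is a constant $C<\infty$ such that $$\Big(\int_{\mathbb R^d} g^{q_0}w^{q_0}\,dx\Big)^{1/q_0}\le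 C\Big(\int_{\mathbb R^d} f^{p_0}w^{p_0}\,dx\Big)^{1/p_0}\qquad\text{for all }(g,f)\in\mathcal F .$$ Then for all $1<p<\infty$ and $0<q,t<\infty$ with $$\frac1p-\frac1{p_0}=\frac1q-\frac1{q_0}=\frac1t-\frac1{t_0},$$ and for every $v\in A^u_{p,t}$, there is a constant $C<\infty$ such that $$\Big(\int_{\mathbb R^d} g^{q}v^{q}\,dx\Big)^{1/q}\le C\Big(\int_{\mathbb R^d} f^{p}v^{p}\,dx\Big)^{1/p}\qquad\text{for all }(g,f)\in\mathcal F .$$ Moreover, if for each $K<\infty$ the constant in the assumption can be chosen uniformly for all $w\in A^u_{p_0,t_0}$ with $[w]_{A^u_{p_0,t_0}}\le K$, then for each $K<\infty$ the constant in the conclusion can be chosen uniformly for all $v\in A^u_{p,t}$ with $[v]_{A^u_{p,t}}\le K$. -/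

import Mathlib

open MeasureTheory Set
open scoped ENNReal NNReal

noncomputable section

/-- The closed axis-parallel cube in `ℝ^d` with centre `c` and side length `2 * r`. -/
def cube {d : ℕ} (c : Fin d → ℝ) (r : ℝ) : Set (Fin d → ℝ) :=
  Set.Icc (fun i => c i - r) (fun i => c i + r)

/-- `⟨f ^ s⟩_Q ^ (1 / s)`, the average being with respect to Lebesgue measure; for `s = ∞` this is
`ess sup_Q f`. -/
def avgNorm {d : ℕ} (s : ℝ≥0∞) (f : (Fin d → ℝ) → ℝ≥0∞) (Q : Set (Fin d → ℝ)) : ℝ≥0∞ :=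
  if s = ∞ then essSup f (volume.restrict Q)
  else (⨍⁻ x in Q, f x ^ s.toReal ∂volume) ^ (1 / s.toReal)

/-- `w` is measurable and `0 < w < ∞` almost everywhere. -/
def IsWeight {d : ℕ} (w : (Fin d → ℝ) → ℝ≥0∞) : Prop :=
  AEMeasurable w volume ∧ ∀ᵐ x ∂(volume : Measure (Fin d → ℝ)), 0 < w x ∧ w x < ∞

/-- `[u]_{A_1} = sup_Q ⟨u⟩_Q * ess sup_Q u⁻¹`. -/
def a1Const {d : ℕ} (u : (Fin d → ℝ) → ℝ≥0∞) : ℝ≥0∞ :=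
  ⨆ (c : Fin d → ℝ) (r : ℝ) (_ : 0 < r),
    (⨍⁻ x in cube c r, u x ∂volume) * essSup (fun x => (u x)⁻¹) (volume.restrict (cube c r))

/-- `u ∈ A_1`: a locally integrable weight with `[u]_{A_1} < ∞`. -/
def MemA1 {d : ℕ} (u : (Fin d → ℝ) → ℝ≥0∞) : Prop :=
  IsWeight u ∧ (∀ (c : Fin d → ℝ) (r : ℝ), ∫⁻ x in cube c r, u x ∂volume < ∞) ∧ a1Const u < ∞

/-- `[w]_{A_{p,q}} = sup_Q ⟨(∏ w_i) ^ q⟩_Q ^ (1 / q) * ∏ ⟨w_i ^ (-p_i')⟩_Q ^ (1 / p_i')` for vectors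
`w = (w_1, …, w_m)` and `p = (p_1, …, p_m)`, where `p_i'` is the exponent conjugate to `p_i`;
the factor for `p_i = 1` is `ess sup_Q w_i⁻¹`, and for `q = ∞` the first factor is
`ess sup_Q ∏ w_i`. -/
def apqConst {d m : ℕ} (p : Fin m → ℝ≥0∞) (q : ℝ≥0∞) (w : Fin m → (Fin d → ℝ) → ℝ≥0∞) : ℝ≥0∞ :=
  ⨆ (c : Fin d → ℝ) (r : ℝ) (_ : 0 < r),
    avgNorm q (fun x => ∏ i, w i x) (cube c r) *
      ∏ i, avgNorm (p i).conjExponent (fun x => (w i x)⁻¹) (cube c r)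

/-- The multiple weight class `A_{p,q}`. -/
def MemApq {d m : ℕ} (p : Fin m → ℝ≥0∞) (q : ℝ≥0∞) (w : Fin m → (Fin d → ℝ) → ℝ≥0∞) : Prop :=
  (∀ i, IsWeight (w i)) ∧ apqConst p q w < ∞

/-- `[w]_{A^u_{p,q}} = [(w, u)]_{A_{(p,∞),q}}`. -/
def partialConst {d m : ℕ} (u : (Fin d → ℝ) → ℝ≥0∞) (p : Fin m → ℝ≥0∞) (q : ℝ≥0∞)
    (w : Fin m → (Fin d → ℝ) → ℝ≥0∞) : ℝ≥0∞ :=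
  apqConst (Fin.snoc p ∞ : Fin (m + 1) → ℝ≥0∞) q
    (Fin.snoc w u : Fin (m + 1) → (Fin d → ℝ) → ℝ≥0∞)

/-- The partial multiple weight class: `w ∈ A^u_{p,q}` iff `(w, u) ∈ A_{(p,∞),q}`. -/
def MemPartial {d m : ℕ} (u : (Fin d → ℝ) → ℝ≥0∞) (p : Fin m → ℝ≥0∞) (q : ℝ≥0∞)
    (w : Fin m → (Fin d → ℝ) → ℝ≥0∞) : Prop :=
  MemApq (Fin.snoc p ∞ : Fin (m + 1) → ℝ≥0∞) q
    (Fin.snoc w u : Fin (m + 1) → (Fin d → ℝ) → ℝ≥0∞)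

/-- `[w]_{A^u_{p,t}}` for a single weight and real exponents. -/
def partialConst₁ {d : ℕ} (u : (Fin d → ℝ) → ℝ≥0∞) (p t : ℝ) (w : (Fin d → ℝ) → ℝ≥0∞) : ℝ≥0∞ :=
  partialConst u ![ENNReal.ofReal p] (ENNReal.ofReal t) ![w]

/-- `w ∈ A^u_{p,t}` for a single weight and real exponents. -/
def MemPartial₁ {d : ℕ} (u : (Fin d → ℝ) → ℝ≥0∞) (p t : ℝ) (w : (Fin d → ℝ) → ℝ≥0∞) : Prop :=
  MemPartial u ![ENNReal.ofReal p] (ENNReal.ofReal t) ![w]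

/-- `(∫ h(x) ^ s * w(x) ^ s dx) ^ (1 / s)`, the norm of `h ≥ 0` in `L^s(w^s)`. -/
def weightedNorm {d : ℕ} (s : ℝ) (h w : (Fin d → ℝ) → ℝ≥0∞) : ℝ≥0∞ :=
  (∫⁻ x, h x ^ s * w x ^ s ∂volume) ^ (1 / s)

end

/-! Put `a = 1/t`, `b = 1/p'`, `ν = (uv)^t`, `τ = v^(-p')`, so that `ν^a * τ^b = u`. The condition
on `v` becomes `JointBound`: `ν(Q)^a τ(Q)^b ∫_Q u⁻¹ ≲ |Q|^(a+b+1)`. With `U = u^(1/(a+b))`, Hölder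
gives `|Q|^(a+b+1) ≤ U(Q)^(a+b) ∫_Q u⁻¹`, and dividing by `∫ u⁻¹` leaves `ν(4Q)^a τ(4Q)^b ≲
U(Q)^(a+b)`. This is a Muckenhoupt condition relative to the measure `U dx`, with dual densities `ν`
and `τ` (`JointBound.isDualPair`).

The maximal operator `M_U` is therefore bounded on `L^s(ν)`, `s = (a+b)/a`
(`lintegral_maxFn_rpow_mul_le`): it is dominated pointwise by a composition of `M_ν` and `M_τ`
(`maxFn_rpow_le`), whose own `L^p` bounds hold for arbitrary measures by the Besicovitch covering
theorem. The Rubio de Francia iteration (`exists_majorant`) turns any `h` with `∫ h ≤ 1` into `G ≥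
h` with `∫ G ≲ 1` and `(G/ν)^(1/s)` an `A_1` function relative to `U`. Multiplying `v` by `G^(1/p₀ -
1/p)` then yields a weight for `(p₀, t₀)` (`exists_joint_weight`, `exists_partial_weight`). The case
`p < p₀` uses `(ν, τ)` and the case `p > p₀` uses `(τ, ν)`.

Extrapolation is Hölder on one side of the inequality and `h ≤ G` on the other. Here `h` dominates a
normalised `(fv)^p` if `p ≤ p₀` and `(gv)^q` if `p ≥ p₀`. When the assumed constant depends on the
weight, one weight must serve a whole sequence of putative counterexamples; `exists_common_majorant`
supplies one `h` for all of them at a cost `2^(n+2)`, and a diagonal argument concludes. -/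

/-! ### Maximal functions with respect to arbitrary measures. -/

section MaximalFunction

variable {E : Type*} [MetricSpace E] [MeasurableSpace E]

/-- The centred maximal function with respect to `ρ` over closed balls of dyadic radius. -/
noncomputable def maxFn (ρ : Measure E) (f : E → ℝ≥0∞) (x : E) : ℝ≥0∞ :=
  ⨆ n : ℤ, (∫⁻ y in Metric.closedBall x ((2 : ℝ) ^ n), f y ∂ρ) /
    ρ (Metric.closedBall x ((2 : ℝ) ^ n))

/-- The pointwise layer-cake formula, valid also at `a = ∞`, where both sides are infinite. -/
theorem lintegral_rpow_sub_one_lt (a : ℝ≥0∞) {p : ℝ} (hp : 0 < p) :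
    ∫⁻ l in {l : ℝ | 0 < l ∧ ENNReal.ofReal l < a}, ENNReal.ofReal (l ^ (p - 1))
      = a ^ p / ENNReal.ofReal p := by
  have key : ∀ A : ℝ, 0 ≤ A →
      ∫⁻ l in Ioo 0 A, ENNReal.ofReal (l ^ (p - 1)) = ENNReal.ofReal A ^ p / ENNReal.ofReal p := by
    intro A hA
    rw [ENNReal.ofReal_rpow_of_nonneg hA hp.le, ← ENNReal.ofReal_div_of_pos hp,
      setLIntegral_congr Ioo_ae_eq_Ioc, ← ofReal_integral_eq_lintegral_ofReal]
    · rw [← intervalIntegral.integral_of_le hA, integral_rpow (Or.inl (by linarith))]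
      simp [hp.ne']
    · exact (intervalIntegrable_iff_integrableOn_Ioc_of_le hA).1
        (intervalIntegral.intervalIntegrable_rpow' (by linarith))
    · filter_upwards [ae_restrict_mem measurableSet_Ioc] with x hx
      exact Real.rpow_nonneg hx.1.le _
  rcases eq_or_ne a ∞ with rfl | ha
  · rw [ENNReal.top_rpow_of_pos hp, ENNReal.top_div_of_ne_top ENNReal.ofReal_ne_top]
    refine ENNReal.eq_top_of_forall_nnreal_le fun r => ?_
    set A : ℝ := (r * p) ^ (1 / p) with hA
    have hA0 : 0 ≤ A := by positivity
    have h1 : A ^ p = r * p := by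
      rw [hA, ← Real.rpow_mul (by positivity), one_div_mul_cancel hp.ne', Real.rpow_one]
    calc (r : ℝ≥0∞) = ENNReal.ofReal A ^ p / ENNReal.ofReal p := by
          rw [ENNReal.ofReal_rpow_of_nonneg hA0 hp.le, ← ENNReal.ofReal_div_of_pos hp, h1,
            mul_div_cancel_right₀ _ hp.ne', ENNReal.ofReal_coe_nnreal]
      _ = _ := (key A hA0).symm
      _ ≤ _ := lintegral_mono_set fun l (hl : l ∈ Ioo 0 A) => by
          exact ⟨hl.1, ENNReal.ofReal_lt_top⟩
  · rw [← ENNReal.ofReal_toReal ha, ← key _ ENNReal.toReal_nonneg]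
    congr 2
    ext l
    simp only [mem_ofPred_eq, mem_Ioo]
    refine and_congr_right fun hl => ?_
    rw [ENNReal.ofReal_lt_ofReal_iff_of_nonneg hl.le]

theorem maxFn_le_add [OpensMeasurableSpace E] (ρ : Measure E) (f g : E → ℝ≥0∞) (c : ℝ≥0∞)
    (hg : Measurable g) (h : ∀ x, f x ≤ g x + c) (x : E) : maxFn ρ f x ≤ maxFn ρ g x + c := by
  refine iSup_le fun n => ?_
  set B := Metric.closedBall x ((2 : ℝ) ^ n)
  calc (∫⁻ y in B, f y ∂ρ) / ρ B ≤ ((∫⁻ y in B, g y ∂ρ) + c * ρ B) / ρ B := by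
        gcongr
        calc _ ≤ ∫⁻ y in B, (g y + c) ∂ρ := lintegral_mono fun y => h y
          _ = _ := by rw [lintegral_add_left hg, setLIntegral_const]
    _ = (∫⁻ y in B, g y ∂ρ) / ρ B + c * ρ B / ρ B := ENNReal.add_div
    _ ≤ _ := by
        gcongr
        · exact le_iSup (fun n : ℤ => (∫⁻ y in Metric.closedBall x ((2 : ℝ) ^ n), g y ∂ρ) /
            ρ (Metric.closedBall x ((2 : ℝ) ^ n))) n
        · rw [mul_comm]; exact ENNReal.div_le_of_le_mul (by rw [mul_comm])

variable [SecondCountableTopology E] [BorelSpace E]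

theorem measurable_measure_closedBall (ρ : Measure E) [SFinite ρ] (r : ℝ) :
    Measurable fun x => ρ (Metric.closedBall x r) := by
  have hs : MeasurableSet {z : E × E | dist z.2 z.1 ≤ r} :=
    (isClosed_le (by fun_prop) continuous_const).measurableSet
  exact measurable_measure_prodMk_left (ν := ρ) hs

/-- Dyadic radii make the supremum countable. The numerator is the measure of a ball under
`ρ.withDensity f`, so `f` itself may be arbitrary. -/
theorem measurable_maxFn (ρ : Measure E) [SFinite ρ] (f : E → ℝ≥0∞) :
    Measurable (maxFn ρ f) := by
  refine Measurable.iSup fun n => ?_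
  refine Measurable.div ?_ (measurable_measure_closedBall ρ _)
  have := measurable_measure_closedBall (ρ.withDensity f) ((2 : ℝ) ^ n)
  simpa only [withDensity_apply _ Metric.isClosed_closedBall.measurableSet] using this

/-- The Besicovitch theorem covers the centres by `N` disjoint families of the selected balls, on
each of which the integrals of `f` add up to at most the total. No doubling is needed, so `N`
depends on the space only. -/
theorem mul_measure_lt_maxFn_le [HasBesicovitchCovering E] :
    ∃ N : ℕ, ∀ (ρ : Measure E) [SFinite ρ] (f : E → ℝ≥0∞) (l : ℝ≥0∞),
      l * ρ {x | l < maxFn ρ f x} ≤ N * ∫⁻ x, f x ∂ρ := by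
  obtain ⟨N, τ, hτ, hN⟩ := HasBesicovitchCovering.no_satelliteConfig (α := E)
  refine ⟨N, fun ρ _ f l => ?_⟩
  set I : E → ℤ → ℝ≥0∞ := fun x n => (∫⁻ y in Metric.closedBall x ((2 : ℝ) ^ n), f y ∂ρ) /
    ρ (Metric.closedBall x ((2 : ℝ) ^ n)) with hI
  set A : ℕ → Set E := fun m => {x | ∃ n : ℤ, n ≤ m ∧ l < I x n} with hA
  have hU : {x | l < maxFn ρ f x} = ⋃ m, A m := by
    ext x
    simp only [maxFn, mem_ofPred_eq, lt_iSup_iff, mem_iUnion, hA, hI]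
    constructor
    · rintro ⟨n, hn⟩
      exact ⟨n.toNat, n, Int.self_le_toNat n, hn⟩
    · rintro ⟨m, n, -, hn⟩
      exact ⟨n, hn⟩
  have hmono : Monotone A := by
    rintro m m' h x ⟨n, hn, hx⟩
    exact ⟨n, hn.trans (by exact_mod_cast h), hx⟩
  -- The covering theorem needs bounded radii, hence the exhaustion by radii at most `2^m`.
  rw [hU, hmono.measure_iUnion, ENNReal.mul_iSup]
  refine iSup_le fun m => ?_
  choose n hn hx using fun x : A m => x.2
  let q : Besicovitch.BallPackage (A m) E :=
    { c := fun x => x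
      r := fun x => (2 : ℝ) ^ n x
      rpos := fun x => by positivity
      r_bound := (2 : ℝ) ^ (m : ℤ)
      r_le := fun x => zpow_le_zpow_right₀ (by norm_num) (hn x) }
  obtain ⟨s, hdisj, hcov⟩ := Besicovitch.exist_disjoint_covering_families hτ hN q
  have hcount : ∀ i, (s i).Countable := fun i => by
    refine (hdisj i).countable_of_nonempty_interior fun x _ => ?_
    refine ⟨q.c x, Metric.ball_subset_interior_closedBall ?_⟩
    exact Metric.mem_ball_self (q.rpos x)
  calc l * ρ (A m) ≤ l * ρ (⋃ i : Fin N, ⋃ j ∈ s i, Metric.closedBall (q.c j) (q.r j)) := by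
        gcongr
        intro x hx
        have := hcov ⟨⟨x, hx⟩, rfl⟩
        simp only [mem_iUnion] at this ⊢
        obtain ⟨i, j, hj, h⟩ := this
        exact ⟨i, j, hj, Metric.ball_subset_closedBall h⟩
    _ ≤ l * ∑ i : Fin N, ∑' j : s i, ρ (Metric.closedBall (q.c j) (q.r j)) := by
        gcongr
        refine (measure_iUnion_fintype_le _ _).trans (Finset.sum_le_sum fun i _ => ?_)
        exact measure_biUnion_le ρ (hcount i) _
    _ = ∑ i : Fin N, ∑' j : s i, l * ρ (Metric.closedBall (q.c j) (q.r j)) := by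
        simp_rw [Finset.mul_sum, ENNReal.tsum_mul_left]
    _ ≤ ∑ i : Fin N, ∑' j : s i, ∫⁻ y in Metric.closedBall (q.c j) (q.r j), f y ∂ρ := by
        gcongr with i _ j
        exact ENNReal.mul_le_of_le_div (hx j.1).le
    _ ≤ ∑ i : Fin N, ∫⁻ y, f y ∂ρ := by
        refine Finset.sum_le_sum fun i _ => ?_
        have := hcount i
        rw [← lintegral_biUnion (hcount i)
          (fun _ _ => Metric.isClosed_closedBall.measurableSet) (hdisj i)]
        exact setLIntegral_le_lintegral _ _
    _ = N * ∫⁻ x, f x ∂ρ := by simp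

/-- Marcinkiewicz interpolation between the weak `(1,1)` bound and the trivial bound at infinity,
with a constant independent of `ρ`. This uniformity allows `ρ` to be one of the weights later. -/
theorem lintegral_maxFn_rpow_le [HasBesicovitchCovering E] {p : ℝ} (hp : 1 < p) :
    ∃ C : ℝ≥0, ∀ (ρ : Measure E) [SFinite ρ] (f : E → ℝ≥0∞), Measurable f →
      ∫⁻ x, maxFn ρ f x ^ p ∂ρ ≤ C * ∫⁻ x, f x ^ p ∂ρ := by
  obtain ⟨N, hN⟩ := mul_measure_lt_maxFn_le (E := E)
  have hp0 : 0 < p := by linarith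
  have hp1 : 0 < p - 1 := by linarith
  set C : ℝ≥0∞ := ENNReal.ofReal p * (2 * N * (2 ^ (p - 1) / ENNReal.ofReal (p - 1))) with hC
  have hCtop : C ≠ ∞ := by
    refine ENNReal.mul_ne_top ENNReal.ofReal_ne_top (ENNReal.mul_ne_top ?_ ?_)
    · exact ENNReal.mul_ne_top (by norm_num) (ENNReal.natCast_ne_top N)
    · exact ENNReal.div_ne_top (ENNReal.rpow_ne_top_of_nonneg hp1.le (by norm_num))
        (by simpa using hp1)
  refine ⟨C.toNNReal, fun ρ _ f hf => ?_⟩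
  rw [ENNReal.coe_toNNReal hCtop]
  have hM := measurable_maxFn ρ f
  have repr : ∀ {q : ℝ} (_ : 0 < q) (a : ℝ≥0∞), a ^ q / ENNReal.ofReal q =
      ∫⁻ l in Ioi (0 : ℝ), {l : ℝ | ENNReal.ofReal l < a}.indicator
        (fun l => ENNReal.ofReal (l ^ (q - 1))) l := by
    intro q hq a
    have hms : MeasurableSet {l : ℝ | ENNReal.ofReal l < a} :=
      measurableSet_lt (by fun_prop) measurable_const
    rw [← lintegral_rpow_sub_one_lt a hq, lintegral_indicator hms,
      Measure.restrict_restrict hms]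
    congr 2
    ext l; simp [and_comm]
  have hpp : ENNReal.ofReal p ≠ 0 := by simpa using hp0
  have meas_ind : ∀ (g : E → ℝ≥0∞), Measurable g → ∀ q : ℝ,
      Measurable (Function.uncurry fun (x : E) (l : ℝ) =>
        {l : ℝ | ENNReal.ofReal l < g x}.indicator (fun l => ENNReal.ofReal (l ^ (q - 1))) l) := by
    intro g hg q
    have hs : MeasurableSet {z : E × ℝ | ENNReal.ofReal z.2 < g z.1} :=
      measurableSet_lt (by fun_prop) (by fun_prop)
    have : Measurable ({z : E × ℝ | ENNReal.ofReal z.2 < g z.1}.indicator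
      (fun z : E × ℝ => ENNReal.ofReal (z.2 ^ (q - 1)))) :=
      Measurable.indicator (by fun_prop) hs
    exact this
  calc ∫⁻ x, maxFn ρ f x ^ p ∂ρ
      = ENNReal.ofReal p * ∫⁻ x, maxFn ρ f x ^ p / ENNReal.ofReal p ∂ρ := by
        rw [← lintegral_const_mul' _ _ ENNReal.ofReal_ne_top]
        refine lintegral_congr fun x => ?_
        rw [ENNReal.mul_div_cancel hpp ENNReal.ofReal_ne_top]
    _ = ENNReal.ofReal p * ∫⁻ l in Ioi (0 : ℝ), ∫⁻ x,
        {l : ℝ | ENNReal.ofReal l < maxFn ρ f x}.indicator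
        (fun l => ENNReal.ofReal (l ^ (p - 1))) l ∂ρ := by
        simp_rw [repr hp0]
        rw [lintegral_lintegral_swap (meas_ind _ hM p).aemeasurable]
    _ ≤ ENNReal.ofReal p * ∫⁻ l in Ioi (0 : ℝ), ∫⁻ x, 2 * N * (f x *
        {l : ℝ | ENNReal.ofReal l < 2 * f x}.indicator
        (fun l => ENNReal.ofReal (l ^ (p - 1 - 1))) l) ∂ρ := by
        gcongr ENNReal.ofReal p * ?_
        refine setLIntegral_mono' measurableSet_Ioi fun l hl => ?_
        have hl : 0 < l := hl
        set S : Set E := {x | ENNReal.ofReal l < 2 * f x} with hS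
        have hSm : MeasurableSet S := measurableSet_lt measurable_const (by fun_prop)
        have hT : MeasurableSet {x | ENNReal.ofReal l < maxFn ρ f x} :=
          measurableSet_lt measurable_const hM
        -- Off `S`, `f` is at most `l / 2`, so the discarded part contributes at most `l / 2` to the
        -- maximal function.
        have hsub : {x | ENNReal.ofReal l < maxFn ρ f x} ⊆
            {x | ENNReal.ofReal l / 2 < maxFn ρ (S.indicator f) x} := by
          intro x hx
          simp only [mem_ofPred_eq] at hx ⊢
          by_contra! hcon
          refine hx.not_ge ?_
          calc maxFn ρ f x ≤ maxFn ρ (S.indicator f) x + ENNReal.ofReal l / 2 := by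
                refine maxFn_le_add ρ f _ _ (hf.indicator hSm) (fun y => ?_) x
                by_cases hy : y ∈ S
                · simp [hy]
                · simp only [hy, not_false_eq_true, indicator_of_notMem, zero_add]
                  simp only [hS, mem_ofPred_eq, not_lt] at hy
                  rw [ENNReal.le_div_iff_mul_le (by simp) (by simp), mul_comm]
                  exact hy
            _ ≤ ENNReal.ofReal l / 2 + ENNReal.ofReal l / 2 := by gcongr
            _ = _ := ENNReal.add_halves _
        have hw : ENNReal.ofReal l * ρ {x | ENNReal.ofReal l < maxFn ρ f x} ≤
            2 * (N * ∫⁻ x, S.indicator f x ∂ρ) := by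
          calc _ = 2 * (ENNReal.ofReal l / 2 * ρ {x | ENNReal.ofReal l < maxFn ρ f x}) := by
                rw [← mul_assoc, ENNReal.mul_div_cancel (by simp) (by simp)]
            _ ≤ 2 * (ENNReal.ofReal l / 2 * ρ {x | ENNReal.ofReal l / 2 <
                  maxFn ρ (S.indicator f) x}) := by gcongr
            _ ≤ _ := by gcongr 2 * ?_; exact hN ρ _ _
        calc ∫⁻ x, {l : ℝ | ENNReal.ofReal l < maxFn ρ f x}.indicator
              (fun l => ENNReal.ofReal (l ^ (p - 1))) l ∂ρ
            = ∫⁻ x, {x | ENNReal.ofReal l < maxFn ρ f x}.indicator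
              (fun _ => ENNReal.ofReal (l ^ (p - 1))) x ∂ρ := rfl
          _ = ENNReal.ofReal (l ^ (p - 1)) * ρ {x | ENNReal.ofReal l < maxFn ρ f x} := by
              rw [lintegral_indicator hT, setLIntegral_const]
          _ = ENNReal.ofReal (l ^ (p - 1 - 1)) *
                (ENNReal.ofReal l * ρ {x | ENNReal.ofReal l < maxFn ρ f x}) := by
              rw [← mul_assoc, ← ENNReal.ofReal_mul (by positivity)]
              congr 2
              nth_rw 3 [← Real.rpow_one l]
              rw [← Real.rpow_add hl, sub_add_cancel]
          _ ≤ ENNReal.ofReal (l ^ (p - 1 - 1)) * (2 * (N * ∫⁻ x, S.indicator f x ∂ρ)) := by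
              gcongr
          _ = ∫⁻ x, ENNReal.ofReal (l ^ (p - 1 - 1)) * (2 * (N * S.indicator f x)) ∂ρ := by
              rw [lintegral_const_mul' _ _ ENNReal.ofReal_ne_top,
                lintegral_const_mul' _ _ (by norm_num),
                lintegral_const_mul' _ _ (ENNReal.natCast_ne_top N)]
          _ = _ := by
              refine lintegral_congr fun x => ?_
              by_cases hx : x ∈ S
              · have hx' : ENNReal.ofReal l < 2 * f x := hx
                simp only [hx, indicator_of_mem, mem_ofPred_eq, hx']
                ring
              · have hx' : ¬ ENNReal.ofReal l < 2 * f x := hx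
                simp [hx, hx']
    _ = ENNReal.ofReal p *
        ∫⁻ x, 2 * N * (f x * ((2 * f x) ^ (p - 1) / ENNReal.ofReal (p - 1))) ∂ρ := by
        rw [lintegral_lintegral_swap]
        · congr 1
          refine lintegral_congr fun x => ?_
          have h1 := meas_ind (fun x => 2 * f x) (by fun_prop) (p - 1)
          have h2 : Measurable fun l => {l : ℝ | ENNReal.ofReal l < 2 * f x}.indicator
            (fun l => ENNReal.ofReal (l ^ (p - 1 - 1))) l := h1.of_uncurry_left
          rw [lintegral_const_mul _ (by fun_prop), lintegral_const_mul _ h2, ← repr hp1]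
        · have h1 := meas_ind (fun x => 2 * f x) (by fun_prop) (p - 1)
          have h2 : Measurable fun z : ℝ × E => 2 * (N : ℝ≥0∞) * (f z.2 *
            {l : ℝ | ENNReal.ofReal l < 2 * f z.2}.indicator
            (fun l => ENNReal.ofReal (l ^ (p - 1 - 1))) z.1) :=
            ((hf.comp measurable_snd).mul (h1.comp measurable_swap)).const_mul _
          exact h2.aemeasurable
    _ = _ := by
        rw [hC, mul_assoc, ← lintegral_const_mul _ (hf.pow_const p)]
        congr 1
        refine lintegral_congr fun x => ?_
        rw [ENNReal.mul_rpow_of_nonneg _ _ hp1.le]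
        have : f x ^ p = f x * f x ^ (p - 1) := by
          nth_rw 2 [← ENNReal.rpow_one (f x)]
          rw [← ENNReal.rpow_add_of_nonneg _ _ zero_le_one hp1.le, add_sub_cancel]
        rw [this, div_eq_mul_inv, div_eq_mul_inv]
        ring

end MaximalFunction

/-! ### Exponential coordinates: identities between monomials in positive finite quantities become
linear identities between exponents. -/

section Exponential

/-- The exponential function with values in `ℝ≥0∞`. -/
noncomputable def eexp (x : ℝ) : ℝ≥0∞ := ENNReal.ofReal (Real.exp x)

theorem exists_eq_eexp {x : ℝ≥0∞} (h0 : x ≠ 0) (h1 : x ≠ ∞) : ∃ y, x = eexp y :=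
  ⟨Real.log x.toReal, by
    rw [eexp, Real.exp_log (ENNReal.toReal_pos h0 h1), ENNReal.ofReal_toReal h1]⟩

theorem eexp_ne_zero (x : ℝ) : eexp x ≠ 0 := by simp [eexp, Real.exp_pos]

theorem eexp_ne_top (x : ℝ) : eexp x ≠ ∞ := ENNReal.ofReal_ne_top

theorem eexp_mul (x y : ℝ) : eexp x * eexp y = eexp (x + y) := by
  rw [eexp, eexp, eexp, Real.exp_add, ENNReal.ofReal_mul (Real.exp_pos x).le]

theorem eexp_inv (x : ℝ) : (eexp x)⁻¹ = eexp (-x) := by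
  rw [eexp, eexp, Real.exp_neg, ENNReal.ofReal_inv_of_pos (Real.exp_pos x)]

theorem eexp_div (x y : ℝ) : eexp x / eexp y = eexp (x - y) := by
  rw [div_eq_mul_inv, eexp_inv, eexp_mul, sub_eq_add_neg]

theorem eexp_rpow (x y : ℝ) : eexp x ^ y = eexp (x * y) := by
  rw [eexp, eexp, ENNReal.ofReal_rpow_of_pos (Real.exp_pos x), Real.exp_mul]

theorem eexp_le_eexp {x y : ℝ} : eexp x ≤ eexp y ↔ x ≤ y := by
  rw [eexp, eexp, ENNReal.ofReal_le_ofReal_iff (Real.exp_pos y).le, Real.exp_le_exp]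

theorem eexp_injective : Function.Injective eexp := fun _ _ h =>
  le_antisymm (eexp_le_eexp.1 h.le) (eexp_le_eexp.1 h.ge)

end Exponential

/-! ### The weighted bound for the maximal function of the base measure. -/

section TwoWeight

variable {E : Type*} [MetricSpace E] [MeasurableSpace E]

/-- The change of density used for duality: with `z = U` it exchanges `ν` and `τ` in the weighted
integrals. -/
theorem div_rpow_mul_self {a b : ℝ} (hb : 0 < b) {x y z : ℝ≥0∞} (hx : x ≠ 0)
    (hx' : x ≠ ∞) (hy : y ≠ 0) (hy' : y ≠ ∞) (hz : z ≠ 0) (hz' : z ≠ ∞)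
    (h : z ^ (a + b) = x ^ a * y ^ b) : (z / x) ^ ((a + b) / b) * x = y := by
  obtain ⟨x, rfl⟩ := exists_eq_eexp hx hx'
  obtain ⟨y, rfl⟩ := exists_eq_eexp hy hy'
  obtain ⟨z, rfl⟩ := exists_eq_eexp hz hz'
  simp only [eexp_rpow, eexp_mul, eexp_div] at h ⊢
  have := eexp_injective h
  congr 1
  field_simp
  linarith

theorem setLIntegral_le_mul_maxFn (ρ : Measure E) (f : E → ℝ≥0∞) (x : E) (n : ℤ)
    (h0 : ρ (Metric.closedBall x ((2 : ℝ) ^ n)) ≠ 0)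
    (h1 : ρ (Metric.closedBall x ((2 : ℝ) ^ n)) ≠ ∞) :
    ∫⁻ y in Metric.closedBall x ((2 : ℝ) ^ n), f y ∂ρ ≤
      ρ (Metric.closedBall x ((2 : ℝ) ^ n)) * maxFn ρ f x := by
  rw [mul_comm, ← ENNReal.div_le_iff h0 h1]
  exact le_iSup (fun n : ℤ => (∫⁻ y in Metric.closedBall x ((2 : ℝ) ^ n), f y ∂ρ) /
    ρ (Metric.closedBall x ((2 : ℝ) ^ n))) n

/-- `ν` and `τ` are the densities, with respect to `μ`, of a pair of dual weights relative to the
base density `U = (ν ^ a * τ ^ b) ^ (1 / (a + b))`, with Muckenhoupt constant `L`. -/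
structure IsDualPair (μ : Measure E) (a b : ℝ) (L : ℝ≥0∞) (ν τ U : E → ℝ≥0∞) : Prop where
  measurable_left : Measurable ν
  measurable_right : Measurable τ
  measurable_base : Measurable U
  left_ne_zero : ∀ x, ν x ≠ 0
  left_ne_top : ∀ x, ν x ≠ ∞
  right_ne_zero : ∀ x, τ x ≠ 0
  right_ne_top : ∀ x, τ x ≠ ∞
  base_rpow : ∀ x, U x ^ (a + b) = ν x ^ a * τ x ^ b
  lintegral_left_ne_zero : ∀ x r, 0 < r → ∫⁻ y in Metric.closedBall x r, ν y ∂μ ≠ 0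
  lintegral_left_ne_top : ∀ x r, 0 < r → ∫⁻ y in Metric.closedBall x r, ν y ∂μ ≠ ∞
  lintegral_right_ne_zero : ∀ x r, 0 < r → ∫⁻ y in Metric.closedBall x r, τ y ∂μ ≠ 0
  lintegral_right_ne_top : ∀ x r, 0 < r → ∫⁻ y in Metric.closedBall x r, τ y ∂μ ≠ ∞
  lintegral_base_ne_zero : ∀ x r, 0 < r → ∫⁻ y in Metric.closedBall x r, U y ∂μ ≠ 0
  lintegral_base_ne_top : ∀ x r, 0 < r → ∫⁻ y in Metric.closedBall x r, U y ∂μ ≠ ∞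
  le_base : ∀ x r, 0 < r → (∫⁻ y in Metric.closedBall x (4 * r), ν y ∂μ) ^ a *
    (∫⁻ y in Metric.closedBall x (4 * r), τ y ∂μ) ^ b ≤
      L * (∫⁻ y in Metric.closedBall x r, U y ∂μ) ^ (a + b)

theorem IsDualPair.base_ne_top {μ : Measure E} {a b : ℝ} {L : ℝ≥0∞} {ν τ U : E → ℝ≥0∞}
    (h : IsDualPair μ a b L ν τ U) (ha : 0 < a) (hb : 0 < b) (x : E) : U x ≠ ∞ := fun hx => by
  have := h.base_rpow x
  rw [hx, ENNReal.top_rpow_of_pos (by positivity)] at this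
  exact ENNReal.mul_ne_top (ENNReal.rpow_ne_top_of_nonneg ha.le (h.left_ne_top x))
    (ENNReal.rpow_ne_top_of_nonneg hb.le (h.right_ne_top x)) this.symm

theorem IsDualPair.base_ne_zero {μ : Measure E} {a b : ℝ} {L : ℝ≥0∞} {ν τ U : E → ℝ≥0∞}
    (h : IsDualPair μ a b L ν τ U) (ha : 0 < a) (hb : 0 < b) (x : E) : U x ≠ 0 := fun hx => by
  have := h.base_rpow x
  rw [hx, ENNReal.zero_rpow_of_pos (by positivity)] at this
  exact mul_ne_zero (by simp [h.left_ne_zero, h.left_ne_top])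
    (by simp [h.right_ne_zero, h.right_ne_top]) this.symm

variable [SecondCountableTopology E] [BorelSpace E]

/-- The maximal function of the base measure is controlled by iterated maximal functions with
respect to the two dual weights. -/
theorem maxFn_rpow_le {μ : Measure E} [SFinite μ] {a b : ℝ} (ha : 0 < a) (hb : 0 < b)
    {L : ℝ≥0∞} {ν τ U : E → ℝ≥0∞} (H : IsDualPair μ a b L ν τ U)
    {f : E → ℝ≥0∞} (hf : Measurable f) (x : E) :
    maxFn (μ.withDensity U) f x ^ (b / a) ≤ L ^ (1 / a) * maxFn (μ.withDensity ν)
      (fun y => maxFn (μ.withDensity τ) (fun z => f z * U z / τ z) y ^ (b / a) *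
        (U y / ν y)) x := by
  obtain ⟨hν, hτ, hU, hν0, hν1, hτ0, hτ1, -, hνB', hνB, hτB', hτB, hUB', hUB, hL⟩ := H
  have hba : 0 < b / a := by positivity
  set F := maxFn (μ.withDensity τ) (fun z => f z * U z / τ z) with hF
  have hFm : Measurable F := measurable_maxFn _ _
  set g : E → ℝ≥0∞ := fun y => F y ^ (b / a) * (U y / ν y) with hg
  have hgm : Measurable g := by fun_prop
  have hball : ∀ x r, MeasurableSet (Metric.closedBall (x : E) r) := fun x r =>
    Metric.isClosed_closedBall.measurableSet
  suffices ∀ n : ℤ, ((∫⁻ y in Metric.closedBall x ((2 : ℝ) ^ n), f y ∂(μ.withDensity U)) /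
      (μ.withDensity U) (Metric.closedBall x ((2 : ℝ) ^ n))) ^ (b / a) ≤
      L ^ (1 / a) * maxFn (μ.withDensity ν) g x by
    rw [← ENNReal.le_rpow_inv_iff hba]
    exact iSup_le fun n => (ENNReal.le_rpow_inv_iff hba).2 (this n)
  intro n
  have hr : (0 : ℝ) < 2 ^ n := by positivity
  have hr4 : (0 : ℝ) < 4 * 2 ^ n := by positivity
  set Q := Metric.closedBall x ((2 : ℝ) ^ n)
  set Q' := Metric.closedBall x (4 * (2 : ℝ) ^ n)
  have hQQ' : Q ⊆ Q' := Metric.closedBall_subset_closedBall (by linarith)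
  set I := ∫⁻ y in Q, f y * U y ∂μ with hI
  have hI' : ∫⁻ y in Q, f y ∂(μ.withDensity U) = I := by
    rw [setLIntegral_withDensity_eq_setLIntegral_mul _ hU hf (hball _ _)]
    rw [hI]
    simp only [Pi.mul_apply, mul_comm, Q]
  rw [hI', withDensity_apply _ (hball _ _)]
  set V := ∫⁻ y in Q, U y ∂μ
  set T := ∫⁻ y in Q', τ y ∂μ
  set N := ∫⁻ y in Q', ν y ∂μ
  -- The ball of radius `2^(n+1)` about `y` contains `Q` and lies in `Q'`, since `2 + 1 ≤ 4`.
  have step1 : ∀ y ∈ Q, I / T ≤ F y := by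
    intro y hy
    have h2 : (2 : ℝ) ^ (n + 1) = 2 * 2 ^ n := by rw [zpow_add₀ (by norm_num)]; ring
    have hd : dist y x ≤ 2 ^ n := hy
    have s1 : Q ⊆ Metric.closedBall y ((2 : ℝ) ^ (n + 1)) :=
      Metric.closedBall_subset_closedBall' (by rw [h2, dist_comm]; linarith)
    have s2 : Metric.closedBall y ((2 : ℝ) ^ (n + 1)) ⊆ Q' :=
      Metric.closedBall_subset_closedBall' (by rw [h2]; linarith)
    refine le_trans ?_ (le_iSup _ (n + 1))
    rw [setLIntegral_withDensity_eq_setLIntegral_mul _ hτ (by fun_prop) (hball _ _),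
      withDensity_apply _ (hball _ _)]
    refine ENNReal.div_le_div ?_ (lintegral_mono_set s2)
    calc I ≤ ∫⁻ y in Metric.closedBall y ((2 : ℝ) ^ (n + 1)), f y * U y ∂μ := lintegral_mono_set s1
      _ = _ := by
        refine lintegral_congr fun z => ?_
        rw [Pi.mul_apply, ENNReal.mul_div_cancel (hτ0 z) (hτ1 z)]
  have step2 : V * (I / T) ^ (b / a) ≤ N * maxFn (μ.withDensity ν) g x := by
    calc V * (I / T) ^ (b / a) = ∫⁻ y in Q, U y * (I / T) ^ (b / a) ∂μ := by
          rw [lintegral_mul_const _ hU]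
      _ ≤ ∫⁻ y in Q, U y * F y ^ (b / a) ∂μ := by
          refine setLIntegral_mono' (hball _ _) fun y hy => ?_
          gcongr
          exact step1 y hy
      _ = ∫⁻ y in Q, g y ∂(μ.withDensity ν) := by
          rw [setLIntegral_withDensity_eq_setLIntegral_mul _ hν hgm (hball _ _)]
          refine lintegral_congr fun z => ?_
          simp only [Pi.mul_apply, hg]
          rw [mul_left_comm, ENNReal.mul_div_cancel (hν0 z) (hν1 z), mul_comm]
      _ ≤ (μ.withDensity ν) Q * maxFn (μ.withDensity ν) g x := by
          refine setLIntegral_le_mul_maxFn _ _ _ _ ?_ ?_ <;>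
            rw [withDensity_apply _ (hball _ _)]
          · exact hνB' _ _ hr
          · exact hνB _ _ hr
      _ ≤ _ := by
          gcongr
          rw [withDensity_apply _ (hball _ _)]
          exact lintegral_mono_set hQQ'
  have step3 : N * T ^ (b / a) ≤ L ^ (1 / a) * V ^ ((a + b) / a) := by
    have := ENNReal.rpow_le_rpow (hL x _ hr) (one_div_pos.2 ha).le
    rw [ENNReal.mul_rpow_of_nonneg _ _ (by positivity),
      ENNReal.mul_rpow_of_nonneg _ _ (by positivity), ← ENNReal.rpow_mul, ← ENNReal.rpow_mul,
      ← ENNReal.rpow_mul, mul_one_div_cancel ha.ne', ENNReal.rpow_one] at this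
    simpa only [mul_one_div] using this
  -- Only `V` and `T` are known to be nonzero and finite; `I` and the maximal function may be
  -- infinite and must stay outside the exponential coordinates.
  obtain ⟨v, hv⟩ := exists_eq_eexp (hUB' _ _ hr) (hUB _ _ hr)
  obtain ⟨t, ht⟩ := exists_eq_eexp (hτB' _ _ hr4) (hτB _ _ hr4)
  have hV : V = eexp v := hv
  have hT : T = eexp t := ht
  rw [hV, hT] at step2
  rw [hT, hV] at step3
  rw [hV]
  calc (I / eexp v) ^ (b / a)
      = (eexp v * (I / eexp t) ^ (b / a)) * (eexp t ^ (b / a) * eexp v ^ (-((a + b) / a))) := by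
        rw [div_eq_mul_inv I, div_eq_mul_inv I, ENNReal.mul_rpow_of_nonneg _ _ hba.le,
          ENNReal.mul_rpow_of_nonneg _ _ hba.le]
        have : eexp v * (eexp t)⁻¹ ^ (b / a) * (eexp t ^ (b / a) * eexp v ^ (-((a + b) / a)))
            = (eexp v)⁻¹ ^ (b / a) := by
          simp only [eexp_inv, eexp_rpow, eexp_mul]
          congr 1
          field_simp
          ring
        rw [← this]
        ring
    _ ≤ (N * maxFn (μ.withDensity ν) g x) * (eexp t ^ (b / a) * eexp v ^ (-((a + b) / a))) := by
        gcongr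
    _ = (N * eexp t ^ (b / a)) * (maxFn (μ.withDensity ν) g x * eexp v ^ (-((a + b) / a))) := by
        ring
    _ ≤ (L ^ (1 / a) * eexp v ^ ((a + b) / a)) *
        (maxFn (μ.withDensity ν) g x * eexp v ^ (-((a + b) / a))) := by gcongr
    _ = L ^ (1 / a) * maxFn (μ.withDensity ν) g x *
        (eexp v ^ ((a + b) / a) * eexp v ^ (-((a + b) / a))) := by ring
    _ = _ := by
        simp only [eexp_rpow, eexp_mul]
        rw [show v * ((a + b) / a) + v * (-((a + b) / a)) = 0 by ring]
        simp [eexp]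

/-- After the pointwise bound, `M_ν` is removed on `L^((a+b)/b)(ν)`. The change of density turns
what remains into the `L^((a+b)/a)(τ)` norm of `M_τ`, which is removed there, and a second change of
density returns to `ν`. -/
theorem lintegral_maxFn_rpow_mul_le [HasBesicovitchCovering E] {a b : ℝ} (ha : 0 < a)
    (hb : 0 < b) (L : ℝ≥0) :
    ∃ C : ℝ≥0, ∀ (μ : Measure E) [SFinite μ] (ν τ U : E → ℝ≥0∞),
    IsDualPair μ a b L ν τ U →
    ∀ f : E → ℝ≥0∞, Measurable f →
      ∫⁻ x, maxFn (μ.withDensity U) f x ^ ((a + b) / a) * ν x ∂μ ≤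
        C * ∫⁻ x, f x ^ ((a + b) / a) * ν x ∂μ := by
  have hs : 1 < (a + b) / a := by rw [one_lt_div ha]; linarith
  have hs' : 1 < (a + b) / b := by rw [one_lt_div hb]; linarith
  have hs0 : 0 < (a + b) / a := by linarith
  have hs0' : 0 < (a + b) / b := by linarith
  obtain ⟨C₁, hC₁⟩ := lintegral_maxFn_rpow_le (E := E) hs
  obtain ⟨C₂, hC₂⟩ := lintegral_maxFn_rpow_le (E := E) hs'
  refine ⟨(L ^ (1 / a)) ^ ((a + b) / b) * (C₂ * C₁), fun μ _ ν τ U H f hf => ?_⟩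
  have hU1 := H.base_ne_top ha hb
  have hU0 := H.base_ne_zero ha hb
  have pt := maxFn_rpow_le ha hb H hf
  obtain ⟨hν, hτ, hU, hν0, hν1, hτ0, hτ1, hUeq, -, -, -, -, -, -, -⟩ := H
  set F := maxFn (μ.withDensity τ) (fun z => f z * U z / τ z) with hF
  have hFm : Measurable F := measurable_maxFn _ _
  set g : E → ℝ≥0∞ := fun y => F y ^ (b / a) * (U y / ν y) with hg
  have hgm : Measurable g := by fun_prop
  have hexp : (a + b) / a = b / a * ((a + b) / b) := by field_simp
  have wd : ∀ {w h : E → ℝ≥0∞}, Measurable w → Measurable h →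
      ∫⁻ x, h x ∂(μ.withDensity w) = ∫⁻ x, h x * w x ∂μ := fun {w h} hw hh => by
    rw [lintegral_withDensity_eq_lintegral_mul _ hw hh]
    simp only [Pi.mul_apply, mul_comm]
  have m1 := measurable_maxFn (μ.withDensity ν) g
  calc ∫⁻ x, maxFn (μ.withDensity U) f x ^ ((a + b) / a) * ν x ∂μ
      ≤ ∫⁻ x, ((L : ℝ≥0∞) ^ (1 / a)) ^ ((a + b) / b) *
          (maxFn (μ.withDensity ν) g x ^ ((a + b) / b) * ν x) ∂μ := by
        refine lintegral_mono fun x => ?_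
        rw [hexp, ENNReal.rpow_mul, ← mul_assoc, ← ENNReal.mul_rpow_of_nonneg _ _ hs0'.le]
        gcongr
        exact pt x
    _ = ((L : ℝ≥0∞) ^ (1 / a)) ^ ((a + b) / b) *
          ∫⁻ x, maxFn (μ.withDensity ν) g x ^ ((a + b) / b) ∂(μ.withDensity ν) := by
        rw [wd hν (m1.pow_const _), lintegral_const_mul _ (by fun_prop)]
    _ ≤ ((L : ℝ≥0∞) ^ (1 / a)) ^ ((a + b) / b) *
          (C₂ * ∫⁻ x, g x ^ ((a + b) / b) ∂(μ.withDensity ν)) := by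
        gcongr _ * ?_
        exact hC₂ _ g hgm
    _ = ((L : ℝ≥0∞) ^ (1 / a)) ^ ((a + b) / b) *
          (C₂ * ∫⁻ x, F x ^ ((a + b) / a) ∂(μ.withDensity τ)) := by
        rw [wd hν (by fun_prop), wd hτ (by fun_prop)]
        congr 2
        refine lintegral_congr fun x => ?_
        rw [hg, ENNReal.mul_rpow_of_nonneg _ _ hs0'.le, mul_assoc, ← ENNReal.rpow_mul, ← hexp,
          div_rpow_mul_self hb (hν0 x) (hν1 x) (hτ0 x) (hτ1 x) (hU0 x) (hU1 x) (hUeq x)]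
    _ ≤ ((L : ℝ≥0∞) ^ (1 / a)) ^ ((a + b) / b) *
          (C₂ * (C₁ * ∫⁻ x, (f x * U x / τ x) ^ ((a + b) / a) ∂(μ.withDensity τ))) := by
        gcongr _ * (_ * ?_)
        exact hC₁ _ _ (by fun_prop)
    _ = _ := by
        rw [wd hτ (by fun_prop)]
        have : ∀ x, (f x * U x / τ x) ^ ((a + b) / a) * τ x = f x ^ ((a + b) / a) * ν x := by
          intro x
          rw [mul_div_assoc, ENNReal.mul_rpow_of_nonneg _ _ hs0.le, mul_assoc, add_comm a b,
            div_rpow_mul_self ha (hτ0 x) (hτ1 x) (hν0 x) (hν1 x) (hU0 x) (hU1 x)]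
          rw [add_comm, hUeq, mul_comm]
        simp only [this]
        rw [ENNReal.coe_mul, ENNReal.coe_mul, ENNReal.coe_rpow_of_nonneg _ hs0'.le,
          ENNReal.coe_rpow_of_nonneg _ (by positivity)]
        ring

end TwoWeight

/-! ### The Rubio de Francia iteration and its consequences on balls. -/

section RubioDeFrancia

variable {E : Type*} [MetricSpace E] [MeasurableSpace E]

/-- Hölder's inequality with exponents `(p+q)/p` and `(p+q)/q`, kept in homogeneous form. -/
theorem lintegral_rpow_mul_rpow_le {α : Type*} [MeasurableSpace α] (μ : Measure α)
    {f g : α → ℝ≥0∞} (hf : AEMeasurable f μ) (hg : AEMeasurable g μ) {p q : ℝ} (hp : 0 ≤ p)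
    (hq : 0 ≤ q) (hpq : 0 < p + q) :
    (∫⁻ x, (f x ^ p * g x ^ q) ^ (1 / (p + q)) ∂μ) ^ (p + q) ≤
      (∫⁻ x, f x ∂μ) ^ p * (∫⁻ x, g x ∂μ) ^ q := by
  have h := ENNReal.lintegral_mul_norm_pow_le hf hg (div_nonneg hp hpq.le) (div_nonneg hq hpq.le)
    (by rw [← add_div, div_self hpq.ne'])
  have h' := ENNReal.rpow_le_rpow h hpq.le
  rw [ENNReal.mul_rpow_of_nonneg _ _ hpq.le, ← ENNReal.rpow_mul, ← ENNReal.rpow_mul,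
    div_mul_cancel₀ _ hpq.ne', div_mul_cancel₀ _ hpq.ne'] at h'
  refine le_trans (le_of_eq ?_) h'
  congr 1
  refine lintegral_congr fun x => ?_
  rw [ENNReal.mul_rpow_of_nonneg _ _ (by positivity), ← ENNReal.rpow_mul, ← ENNReal.rpow_mul,
    mul_one_div, mul_one_div]

theorem maxFn_tsum_le (ρ : Measure E) {f : ℕ → E → ℝ≥0∞} (hf : ∀ n, Measurable (f n)) (x : E) :
    maxFn ρ (fun y => ∑' n, f n y) x ≤ ∑' n, maxFn ρ (f n) x := by
  refine iSup_le fun m => ?_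
  rw [lintegral_tsum fun n => (hf n).aemeasurable, div_eq_mul_inv, ← ENNReal.tsum_mul_right]
  exact ENNReal.tsum_le_tsum fun n => le_iSup (fun m : ℤ =>
    (∫⁻ y in Metric.closedBall x ((2 : ℝ) ^ m), f n y ∂ρ) /
      ρ (Metric.closedBall x ((2 : ℝ) ^ m))) m

theorem maxFn_const_mul (ρ : Measure E) {c : ℝ≥0∞} (hc : c ≠ ∞) (f : E → ℝ≥0∞) (x : E) :
    maxFn ρ (fun y => c * f y) x = c * maxFn ρ f x := by
  rw [maxFn, maxFn, ENNReal.mul_iSup]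
  refine iSup_congr fun m => ?_
  rw [lintegral_const_mul' _ _ hc, mul_div_assoc]

/-- A substitute for Minkowski's inequality: half of the factor `4⁻ⁿ` pays for bounding each term by
the whole sum `T`, the other half for summation. -/
theorem rpow_tsum_geometric_le (b : ℕ → ℝ≥0∞) {s : ℝ} (hs : 1 ≤ s) :
    (∑' n, (4⁻¹ : ℝ≥0∞) ^ n * b n) ^ s ≤ 2 ^ s * ∑' n, (2⁻¹ : ℝ≥0∞) ^ n * b n ^ s := by
  have hs0 : 0 < s := by linarith
  set T := ∑' n, (2⁻¹ : ℝ≥0∞) ^ n * b n ^ s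
  have h1 : ∀ n, (2⁻¹ : ℝ≥0∞) ^ n * b n ≤ T ^ (1 / s) := by
    intro n
    rw [one_div, ENNReal.le_rpow_inv_iff hs0, ENNReal.mul_rpow_of_nonneg _ _ hs0.le]
    refine le_trans ?_ (ENNReal.le_tsum n)
    gcongr
    calc ((2⁻¹ : ℝ≥0∞) ^ n) ^ s ≤ ((2⁻¹ : ℝ≥0∞) ^ n) ^ (1 : ℝ) :=
          ENNReal.rpow_le_rpow_of_exponent_ge (pow_le_one₀ (by simp) (by simp)) hs
      _ = _ := ENNReal.rpow_one _
  have h2 : ∑' n, (4⁻¹ : ℝ≥0∞) ^ n * b n ≤ 2 * T ^ (1 / s) := by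
    calc ∑' n, (4⁻¹ : ℝ≥0∞) ^ n * b n = ∑' n, (2⁻¹ : ℝ≥0∞) ^ n * ((2⁻¹ : ℝ≥0∞) ^ n * b n) := by
          refine tsum_congr fun n => ?_
          rw [← mul_assoc, ← mul_pow, ← ENNReal.mul_inv (by simp) (by simp)]
          norm_num
      _ ≤ ∑' n, (2⁻¹ : ℝ≥0∞) ^ n * T ^ (1 / s) := by gcongr with n; exact h1 n
      _ = _ := by
          rw [ENNReal.tsum_mul_right, ENNReal.tsum_geometric, ENNReal.one_sub_inv_two, inv_inv]
  calc _ ≤ (2 * T ^ (1 / s)) ^ s := by gcongr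
    _ = _ := by
      rw [ENNReal.mul_rpow_of_nonneg _ _ hs0.le, ← ENNReal.rpow_mul, one_div_mul_cancel hs0.ne',
        ENNReal.rpow_one]

/-- The Rubio de Francia algorithm for the maximal function with respect to `ρ`. -/
theorem exists_majorant [SecondCountableTopology E] [BorelSpace E] {μ ρ : Measure E} [SFinite ρ]
    {ν : E → ℝ≥0∞} (hν : Measurable ν) {s : ℝ} (hs : 1 ≤ s) {C : ℝ≥0}
    (hC : ∀ f : E → ℝ≥0∞, Measurable f →
      ∫⁻ x, maxFn ρ f x ^ s * ν x ∂μ ≤ C * ∫⁻ x, f x ^ s * ν x ∂μ)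
    {h : E → ℝ≥0∞} (hh : Measurable h) :
    ∃ k : E → ℝ≥0∞, Measurable k ∧ (∀ x, h x ≤ k x) ∧
      ∫⁻ x, k x ^ s * ν x ∂μ ≤ 2 ^ s * 2 * ∫⁻ x, h x ^ s * ν x ∂μ ∧
      ∀ x, maxFn ρ k x ≤ 4 * (max C 1) ^ (1 / s) * k x := by
  have hs0 : 0 < s := by linarith
  -- `A` bounds the operator norm on `L^s(ν)`; the maximum with `1` makes it invertible. The
  -- majorant is `∑ 4⁻ⁿ A⁻ⁿ Mⁿ h`.
  set A : ℝ≥0∞ := ((max C 1 : ℝ≥0) : ℝ≥0∞) ^ (1 / s) with hA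
  have hA0 : A ≠ 0 := by
    rw [hA, ← ENNReal.coe_rpow_of_nonneg _ (by positivity)]
    have : 0 < max C 1 := by positivity
    exact_mod_cast (NNReal.rpow_pos this).ne'
  have hA1 : A ≠ ∞ := ENNReal.rpow_ne_top_of_nonneg (by positivity) ENNReal.coe_ne_top
  have hAs : A ^ s = ((max C 1 : ℝ≥0) : ℝ≥0∞) := by
    rw [hA, ← ENNReal.rpow_mul, one_div_mul_cancel hs0.ne', ENNReal.rpow_one]
  let b : ℕ → E → ℝ≥0∞ := fun n => Nat.rec h (fun _ f x => A⁻¹ * maxFn ρ f x) n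
  have hb0 : b 0 = h := rfl
  have hbs : ∀ n, b (n + 1) = fun x => A⁻¹ * maxFn ρ (b n) x := fun n => rfl
  have hbm : ∀ n, Measurable (b n) := by
    rintro (_ | n)
    · exact hh
    · rw [hbs]; exact (measurable_maxFn ρ _).const_mul _
  have hbint : ∀ n, ∫⁻ x, b n x ^ s * ν x ∂μ ≤ ∫⁻ x, h x ^ s * ν x ∂μ := by
    intro n
    induction n with
    | zero => exact le_rfl
    | succ n ih =>
      refine le_trans ?_ ih
      have : ∀ x, b (n + 1) x ^ s * ν x = (A⁻¹) ^ s * (maxFn ρ (b n) x ^ s * ν x) := fun x => by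
        rw [hbs, ENNReal.mul_rpow_of_nonneg _ _ hs0.le, mul_assoc]
      simp_rw [this]
      rw [lintegral_const_mul' _ _ (ENNReal.rpow_ne_top_of_nonneg hs0.le (by simpa using hA0)),
        ENNReal.inv_rpow, hAs]
      calc _ ≤ ((max C 1 : ℝ≥0) : ℝ≥0∞)⁻¹ * (C * ∫⁻ x, b n x ^ s * ν x ∂μ) := by
            gcongr; exact hC _ (hbm n)
        _ ≤ ((max C 1 : ℝ≥0) : ℝ≥0∞)⁻¹ * ((max C 1 : ℝ≥0) * ∫⁻ x, b n x ^ s * ν x ∂μ) := by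
            gcongr; exact le_max_left _ _
        _ = _ := by
            rw [← mul_assoc, ENNReal.inv_mul_cancel, one_mul]
            · have : 0 < max C 1 := by positivity
              exact_mod_cast this.ne'
            · exact ENNReal.coe_ne_top
  refine ⟨fun x => ∑' n, (4⁻¹ : ℝ≥0∞) ^ n * b n x, ?_, fun x => ?_, ?_, fun x => ?_⟩
  · exact Measurable.tsum fun n => (hbm n).const_mul _
  · refine le_trans ?_ (ENNReal.le_tsum 0)
    simp [hb0]
  · have hm' : ∀ n, Measurable fun x => b n x ^ s * ν x := fun n => ((hbm n).pow_const s).mul hν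
    have hm : ∀ n, Measurable fun x => (2⁻¹ : ℝ≥0∞) ^ n * (b n x ^ s * ν x) :=
      fun n => (hm' n).const_mul _
    calc ∫⁻ x, (∑' n, (4⁻¹ : ℝ≥0∞) ^ n * b n x) ^ s * ν x ∂μ
        ≤ ∫⁻ x, 2 ^ s * ∑' n, (2⁻¹ : ℝ≥0∞) ^ n * (b n x ^ s * ν x) ∂μ := by
          refine lintegral_mono fun x => ?_
          simp_rw [← mul_assoc]
          rw [ENNReal.tsum_mul_right, ← mul_assoc]
          gcongr
          exact rpow_tsum_geometric_le _ hs
      _ = 2 ^ s * ∑' n, (2⁻¹ : ℝ≥0∞) ^ n * ∫⁻ x, b n x ^ s * ν x ∂μ := by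
          rw [lintegral_const_mul' _ _ (ENNReal.rpow_ne_top_of_nonneg hs0.le (by simp)),
            lintegral_tsum fun n => (hm n).aemeasurable]
          congr 1
          refine tsum_congr fun n => ?_
          rw [lintegral_const_mul _ (hm' n)]
      _ ≤ 2 ^ s * ∑' n, (2⁻¹ : ℝ≥0∞) ^ n * ∫⁻ x, h x ^ s * ν x ∂μ := by
          gcongr _ * ?_
          exact ENNReal.tsum_le_tsum fun n => by gcongr _ * ?_; exact hbint n
      _ = _ := by
          rw [ENNReal.tsum_mul_right, ENNReal.tsum_geometric, ENNReal.one_sub_inv_two, inv_inv,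
            mul_assoc]
  · calc maxFn ρ (fun x => ∑' n, (4⁻¹ : ℝ≥0∞) ^ n * b n x) x
        ≤ ∑' n, maxFn ρ (fun x => (4⁻¹ : ℝ≥0∞) ^ n * b n x) x :=
          maxFn_tsum_le ρ (fun n => (hbm n).const_mul _) x
      -- Applying the maximal operator shifts the series by one index, at the cost of the ratio `4 *
      -- A`.
      _ = ∑' n, 4 * A * ((4⁻¹ : ℝ≥0∞) ^ (n + 1) * b (n + 1) x) := by
          refine tsum_congr fun n => ?_
          rw [maxFn_const_mul _ (ENNReal.pow_ne_top (by simp)), hbs, pow_succ]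
          calc _ = (4 * 4⁻¹) * (A * A⁻¹) * (4⁻¹ ^ n * maxFn ρ (b n) x) := by
                rw [ENNReal.mul_inv_cancel (by simp) (by simp), ENNReal.mul_inv_cancel hA0 hA1,
                  one_mul, one_mul]
            _ = _ := by ring
      _ = 4 * A * ∑' n, ((4⁻¹ : ℝ≥0∞) ^ (n + 1) * b (n + 1) x) := ENNReal.tsum_mul_left
      _ ≤ 4 * A * ∑' n, ((4⁻¹ : ℝ≥0∞) ^ n * b n x) := by
          gcongr _ * ?_
          exact ENNReal.tsum_comp_le_tsum_of_injective (add_left_injective 1)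
            fun n => (4⁻¹ : ℝ≥0∞) ^ n * b n x

variable {μ : Measure E} {a b : ℝ} {L : ℝ≥0∞} {ν τ U : E → ℝ≥0∞}

theorem IsDualPair.lintegral_base_rpow_le (H : IsDualPair μ a b L ν τ U) (ha : 0 < a) (hb : 0 < b)
    (s : Set E) : (∫⁻ y in s, U y ∂μ) ^ (a + b) ≤
      (∫⁻ y in s, ν y ∂μ) ^ a * (∫⁻ y in s, τ y ∂μ) ^ b := by
  refine le_trans (le_of_eq ?_) (lintegral_rpow_mul_rpow_le _ H.measurable_left.aemeasurable
    H.measurable_right.aemeasurable ha.le hb.le (by positivity))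
  congr 1
  refine lintegral_congr fun x => ?_
  rw [← H.base_rpow, ← ENNReal.rpow_mul, mul_one_div_cancel (by positivity), ENNReal.rpow_one]

theorem IsDualPair.doubling (H : IsDualPair μ a b L ν τ U) (ha : 0 < a) (hb : 0 < b)
    (x : E) {r : ℝ} (hr : 0 < r) : ∫⁻ y in Metric.closedBall x (4 * r), U y ∂μ ≤
      L ^ (1 / (a + b)) * ∫⁻ y in Metric.closedBall x r, U y ∂μ := by
  have h := (H.lintegral_base_rpow_le ha hb _).trans (H.le_base x r hr)
  have hab : 0 < a + b := by positivity
  have := ENNReal.rpow_le_rpow h (one_div_pos.2 hab).le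
  rwa [ENNReal.mul_rpow_of_nonneg _ _ (one_div_pos.2 hab).le, ← ENNReal.rpow_mul,
    ← ENNReal.rpow_mul, mul_one_div_cancel hab.ne', ENNReal.rpow_one, ENNReal.rpow_one] at this

/-- Doubling of `U` passes from dyadic balls centred at `y` to every ball containing `y`, so `k`
satisfies the full `A_1` condition relative to `U`. -/
theorem IsDualPair.lintegral_mul_le_of_maxFn_le [OpensMeasurableSpace E]
    (H : IsDualPair μ a b L ν τ U) (ha : 0 < a)
    (hb : 0 < b) {k : E → ℝ≥0∞} (hk : Measurable k) {C : ℝ≥0∞}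
    (hkC : ∀ x, maxFn (μ.withDensity U) k x ≤ C * k x) (x : E) {r : ℝ} (hr : 0 < r) {y : E}
    (hy : y ∈ Metric.closedBall x r) : ∫⁻ z in Metric.closedBall x r, k z * U z ∂μ ≤
      (L ^ (1 / (a + b))) ^ 2 * C * (∫⁻ z in Metric.closedBall x r, U z ∂μ) * k y := by
  have hball : ∀ x r, MeasurableSet (Metric.closedBall (x : E) r) := fun x r =>
    Metric.isClosed_closedBall.measurableSet
  -- Here `2r < 2^n ≤ 4r`, so the ball about `y` contains the given one and lies in its 16-fold
  -- dilate. Two applications of doubling by `4` explain the square.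
  obtain ⟨n, hn1, hn2⟩ := exists_mem_Ico_zpow (x := 4 * r) (y := (2 : ℝ)) (by positivity)
    (by norm_num)
  rw [zpow_add₀ (by norm_num), zpow_one] at hn2
  have hd : dist y x ≤ r := hy
  have s1 : Metric.closedBall x r ⊆ Metric.closedBall y ((2 : ℝ) ^ n) :=
    Metric.closedBall_subset_closedBall' (by rw [dist_comm]; linarith)
  have s2 : Metric.closedBall y ((2 : ℝ) ^ n) ⊆ Metric.closedBall x (4 * (4 * r)) :=
    Metric.closedBall_subset_closedBall' (by linarith)
  have wd : (μ.withDensity U) (Metric.closedBall y ((2 : ℝ) ^ n)) =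
      ∫⁻ z in Metric.closedBall y ((2 : ℝ) ^ n), U z ∂μ := withDensity_apply _ (hball _ _)
  calc ∫⁻ z in Metric.closedBall x r, k z * U z ∂μ
      ≤ ∫⁻ z in Metric.closedBall y ((2 : ℝ) ^ n), k z * U z ∂μ := lintegral_mono_set s1
    _ = ∫⁻ z in Metric.closedBall y ((2 : ℝ) ^ n), k z ∂(μ.withDensity U) := by
        rw [setLIntegral_withDensity_eq_setLIntegral_mul _ H.measurable_base hk (hball _ _)]
        simp only [Pi.mul_apply, mul_comm]
    _ ≤ (μ.withDensity U) (Metric.closedBall y ((2 : ℝ) ^ n)) * maxFn (μ.withDensity U) k y := by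
        refine setLIntegral_le_mul_maxFn _ _ _ _ ?_ ?_ <;> rw [wd]
        · exact H.lintegral_base_ne_zero _ _ (by positivity)
        · exact H.lintegral_base_ne_top _ _ (by positivity)
    _ ≤ (∫⁻ z in Metric.closedBall x (4 * (4 * r)), U z ∂μ) * (C * k y) := by
        rw [wd]
        gcongr
        exact hkC y
    _ ≤ (L ^ (1 / (a + b)) * (L ^ (1 / (a + b)) * ∫⁻ z in Metric.closedBall x r, U z ∂μ)) *
        (C * k y) := by
        gcongr
        refine (H.doubling ha hb x (by positivity)).trans ?_
        gcongr
        exact H.doubling ha hb x hr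
    _ = _ := by ring

end RubioDeFrancia

/-! ### From the joint averaging bound to a new pair of weights. -/

section WeightStep

theorem setLIntegral_ne_zero {α : Type*} [MeasurableSpace α] {μ : Measure α} {f : α → ℝ≥0∞}
    (hf : Measurable f) (h0 : ∀ x, f x ≠ 0) {s : Set α} (hs : μ s ≠ 0) :
    ∫⁻ x in s, f x ∂μ ≠ 0 := by
  rw [Ne, lintegral_eq_zero_iff hf]
  intro h
  have : ∀ᵐ x ∂(μ.restrict s), False := by
    filter_upwards [h] with x hx using h0 x hx
  rw [ae_iff] at this
  simp at this
  exact hs this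

variable {d : ℕ}

theorem volume_closedBall_ne_zero (x : Fin d → ℝ) {r : ℝ} (hr : 0 < r) :
    volume (Metric.closedBall x r) ≠ 0 := (Metric.measure_closedBall_pos _ _ hr).ne'

theorem volume_closedBall_ne_top (x : Fin d → ℝ) (r : ℝ) :
    volume (Metric.closedBall x r) ≠ ∞ := measure_closedBall_lt_top.ne

theorem volume_closedBall_four_mul (x : Fin d → ℝ) {r : ℝ} (hr : 0 < r) :
    volume (Metric.closedBall x (4 * r)) = 4 ^ d * volume (Metric.closedBall x r) := by
  rw [Real.volume_pi_closedBall _ hr.le, Real.volume_pi_closedBall _ (by positivity),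
    show 2 * (4 * r) = 4 * (2 * r) by ring, mul_pow, ENNReal.ofReal_mul (by positivity)]
  simp [ENNReal.ofReal_pow]

/-- The joint averaging condition on `ν`, `τ` and `u = ν ^ a * τ ^ b`, in terms of integrals. -/
def JointBound (a b : ℝ) (K : ℝ≥0∞) (ν τ : (Fin d → ℝ) → ℝ≥0∞) : Prop :=
  ∀ (x : Fin d → ℝ) (r : ℝ), 0 < r → (∫⁻ y in Metric.closedBall x r, ν y) ^ a *
    (∫⁻ y in Metric.closedBall x r, τ y) ^ b *
    (∫⁻ y in Metric.closedBall x r, (ν y ^ a * τ y ^ b)⁻¹) ≤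
      K * volume (Metric.closedBall x r) ^ (a + b + 1)

/-- By Hölder's inequality the joint bound also controls `∫ u ^ (1 / (a + b))` from both sides, so
the base measure is doubling without any further hypothesis on `u`. -/
theorem JointBound.isDualPair {a b : ℝ} (ha : 0 < a) (hb : 0 < b) {K : ℝ≥0}
    {ν τ : (Fin d → ℝ) → ℝ≥0∞} (H : JointBound a b K ν τ) (hν : Measurable ν) (hτ : Measurable τ)
    (hν0 : ∀ x, ν x ≠ 0) (hν1 : ∀ x, ν x ≠ ∞) (hτ0 : ∀ x, τ x ≠ 0) (hτ1 : ∀ x, τ x ≠ ∞) :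
    IsDualPair volume a b (K * ((4 : ℝ≥0) ^ d) ^ (a + b + 1) : ℝ≥0) ν τ
      (fun x => (ν x ^ a * τ x ^ b) ^ (1 / (a + b))) := by
  have hab : 0 < a + b := by positivity
  have hu0 : ∀ x, ν x ^ a * τ x ^ b ≠ 0 := fun x =>
    mul_ne_zero (by simp [hν0, hν1]) (by simp [hτ0, hτ1])
  have hu1 : ∀ x, ν x ^ a * τ x ^ b ≠ ∞ := fun x =>
    ENNReal.mul_ne_top (ENNReal.rpow_ne_top_of_nonneg ha.le (hν1 x))
      (ENNReal.rpow_ne_top_of_nonneg hb.le (hτ1 x))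
  have hum : Measurable fun x => ν x ^ a * τ x ^ b := by fun_prop
  have hν0' : ∀ x r, 0 < r → ∫⁻ y in Metric.closedBall x r, ν y ≠ 0 := fun x r hr =>
    setLIntegral_ne_zero hν hν0 (volume_closedBall_ne_zero x hr)
  have hτ0' : ∀ x r, 0 < r → ∫⁻ y in Metric.closedBall x r, τ y ≠ 0 := fun x r hr =>
    setLIntegral_ne_zero hτ hτ0 (volume_closedBall_ne_zero x hr)
  have hJ0' : ∀ x r, 0 < r → ∫⁻ y in Metric.closedBall x r, (ν y ^ a * τ y ^ b)⁻¹ ≠ 0 :=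
    fun x r hr => setLIntegral_ne_zero hum.inv (fun y => by simpa using hu1 y)
      (volume_closedBall_ne_zero x hr)
  have htop : ∀ x r, 0 < r → (∫⁻ y in Metric.closedBall x r, ν y) ^ a *
    (∫⁻ y in Metric.closedBall x r, τ y) ^ b *
    (∫⁻ y in Metric.closedBall x r, (ν y ^ a * τ y ^ b)⁻¹) ≠ ∞ := fun x r hr =>
    ne_top_of_le_ne_top (ENNReal.mul_ne_top ENNReal.coe_ne_top
      (ENNReal.rpow_ne_top_of_nonneg (by positivity) (volume_closedBall_ne_top x r))) (H x r hr)
  have hNT0 : ∀ x r, 0 < r → (∫⁻ y in Metric.closedBall x r, ν y) ^ a ≠ 0 ∧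
      (∫⁻ y in Metric.closedBall x r, τ y) ^ b ≠ 0 := fun x r hr => by
    constructor <;> rw [Ne, ENNReal.rpow_eq_zero_iff] <;> rintro (h | h)
    · exact hν0' x r hr h.1
    · linarith [h.2]
    · exact hτ0' x r hr h.1
    · linarith [h.2]
  -- A finite product of three nonzero factors forces each factor to be finite.
  have hfin : ∀ x r, 0 < r → ∫⁻ y in Metric.closedBall x r, ν y ≠ ∞ ∧
      ∫⁻ y in Metric.closedBall x r, τ y ≠ ∞ ∧
      ∫⁻ y in Metric.closedBall x r, (ν y ^ a * τ y ^ b)⁻¹ ≠ ∞ := by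
    intro x r hr
    have h := htop x r hr
    refine ⟨fun h' => h ?_, fun h' => h ?_, fun h' => h ?_⟩ <;> rw [h']
    · rw [ENNReal.top_rpow_of_pos ha, ENNReal.top_mul (hNT0 x r hr).2,
        ENNReal.top_mul (hJ0' x r hr)]
    · rw [ENNReal.top_rpow_of_pos hb, ENNReal.mul_top (hNT0 x r hr).1,
        ENNReal.top_mul (hJ0' x r hr)]
    · exact ENNReal.mul_top (mul_ne_zero (hNT0 x r hr).1 (hNT0 x r hr).2)
  have hUpow : ∀ x, ((ν x ^ a * τ x ^ b) ^ (1 / (a + b))) ^ (a + b) = ν x ^ a * τ x ^ b :=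
    fun x => by
      rw [← ENNReal.rpow_mul, one_div_mul_cancel hab.ne', ENNReal.rpow_one]
  refine ⟨hν, hτ, by fun_prop, hν0, hν1, hτ0, hτ1, hUpow, hν0', fun x r hr => (hfin x r hr).1,
    hτ0', fun x r hr => (hfin x r hr).2.1, fun x r hr => ?_, fun x r hr => ?_, fun x r hr => ?_⟩
  · refine setLIntegral_ne_zero (by fun_prop) (fun y => ?_) (volume_closedBall_ne_zero x hr)
    simp [hu0 y, hu1 y]
  · have := lintegral_rpow_mul_rpow_le (volume.restrict (Metric.closedBall x r)) hν.aemeasurable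
      hτ.aemeasurable ha.le hb.le hab
    intro h
    rw [h, ENNReal.top_rpow_of_pos hab, top_le_iff] at this
    exact ENNReal.mul_ne_top (ENNReal.rpow_ne_top_of_nonneg ha.le (hfin x r hr).1)
      (ENNReal.rpow_ne_top_of_nonneg hb.le (hfin x r hr).2.1) this
  · set U : (Fin d → ℝ) → ℝ≥0∞ := fun x => (ν x ^ a * τ x ^ b) ^ (1 / (a + b))
    have hUm : Measurable U := by fun_prop
    have hr4 : 0 < 4 * r := by positivity
    set Q := Metric.closedBall x r
    set Q' := Metric.closedBall x (4 * r)
    have hQQ' : Q ⊆ Q' := Metric.closedBall_subset_closedBall (by linarith)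
    set J := ∫⁻ y in Q', (ν y ^ a * τ y ^ b)⁻¹
    -- Hölder applied to `1 = u * u⁻¹`, with `u = U^(a+b)`.
    have hlow : volume Q ^ (a + b + 1) ≤ (∫⁻ y in Q, U y) ^ (a + b) * J := by
      have := lintegral_rpow_mul_rpow_le (volume.restrict Q) hUm.aemeasurable
        hum.inv.aemeasurable hab.le zero_le_one (by positivity)
      simp only [ENNReal.rpow_one, U, hUpow, Pi.inv_apply] at this
      have h1 : ∀ y, (ν y ^ a * τ y ^ b * (ν y ^ a * τ y ^ b)⁻¹) = 1 := fun y =>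
        ENNReal.mul_inv_cancel (hu0 y) (hu1 y)
      simp only [h1, ENNReal.one_rpow, lintegral_const, one_mul, Measure.restrict_apply_univ]
        at this
      refine this.trans ?_
      gcongr
      exact lintegral_mono_set hQQ'
    rw [← ENNReal.mul_le_mul_iff_left (hJ0' x _ hr4) (hfin x _ hr4).2.2]
    calc _ ≤ K * volume Q' ^ (a + b + 1) := H x _ hr4
      _ = K * ((4 : ℝ≥0∞) ^ d) ^ (a + b + 1) * volume Q ^ (a + b + 1) := by
          rw [volume_closedBall_four_mul x hr, ENNReal.mul_rpow_of_nonneg _ _ (by positivity),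
            mul_assoc]
      _ ≤ K * ((4 : ℝ≥0∞) ^ d) ^ (a + b + 1) * ((∫⁻ y in Q, U y) ^ (a + b) * J) := by gcongr
      _ = _ := by
          rw [ENNReal.coe_mul, ENNReal.coe_rpow_of_nonneg _ (by positivity), ENNReal.coe_pow]
          push_cast
          ring

/-- `‖f‖_{L^{1/a}(Q)}`, with the convention `1/0 = ∞`. -/
noncomputable def lpSize (a : ℝ) (f : (Fin d → ℝ) → ℝ≥0∞) (Q : Set (Fin d → ℝ)) : ℝ≥0∞ :=
  if a = 0 then essSup f (volume.restrict Q) else (∫⁻ x in Q, f x ^ (1 / a)) ^ a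

/-- Take `G = k^s ν`, where `k` is the Rubio de Francia majorant of `(h/ν)^(1/s)`. The factor with
`G` in the denominator is controlled by the `A_1` property of `k`, the other by Hölder, and the
averages of `k` cancel in the product. The value `a₀ = 0` is allowed because it occurs, with the
roles exchanged, when `p₀ = 1`. -/
theorem exists_joint_weight {a b a₀ b₀ : ℝ} (ha : 0 < a) (hb : 0 < b) (ha₀ : 0 ≤ a₀)
    (hb₀ : 0 < b₀) (haa : a₀ < a) (hab : a + b = a₀ + b₀) (K : ℝ≥0) :
    ∃ C : ℝ≥0, ∀ ν τ : (Fin d → ℝ) → ℝ≥0∞, JointBound a b K ν τ →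
      Measurable ν → Measurable τ → (∀ x, ν x ≠ 0) → (∀ x, ν x ≠ ∞) → (∀ x, τ x ≠ 0) →
      (∀ x, τ x ≠ ∞) → ∀ h : (Fin d → ℝ) → ℝ≥0∞, Measurable h → (∀ x, h x ≠ 0) →
      ∫⁻ x, h x ≤ 1 → ∃ G : (Fin d → ℝ) → ℝ≥0∞, Measurable G ∧ (∀ x, h x ≤ G x) ∧
        ∫⁻ x, G x ≤ C ∧ ∀ (x : Fin d → ℝ) (r : ℝ), 0 < r →
          lpSize a₀ (fun y => ν y ^ a / G y ^ (a - a₀)) (Metric.closedBall x r) *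
          lpSize b₀ (fun y => τ y ^ b * G y ^ (a - a₀)) (Metric.closedBall x r) *
          (∫⁻ y in Metric.closedBall x r, (ν y ^ a * τ y ^ b)⁻¹) ≤
            C * volume (Metric.closedBall x r) ^ (a + b + 1) := by
  have hδ : 0 < a + b := by positivity
  set L : ℝ≥0 := K * ((4 : ℝ≥0) ^ d) ^ (a + b + 1)
  set s := (a + b) / a with hs_def
  have hs : 1 ≤ s := by rw [hs_def, one_le_div ha]; linarith
  have hs0 : 0 < s := by linarith
  set θ := s * (a - a₀) with hθ
  have hθ0 : 0 < θ := mul_pos hs0 (by linarith)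
  obtain ⟨C₁, hC₁⟩ := lintegral_maxFn_rpow_mul_le (E := Fin d → ℝ) ha hb L
  set D : ℝ≥0∞ := ((L : ℝ≥0∞) ^ (1 / (a + b))) ^ 2 * (4 * (max C₁ 1) ^ (1 / s)) with hD
  have hDtop : D ≠ ∞ := by
    refine ENNReal.mul_ne_top (ENNReal.pow_ne_top
      (ENNReal.rpow_ne_top_of_nonneg (by positivity) ENNReal.coe_ne_top))
      (ENNReal.mul_ne_top (by simp) (ENNReal.rpow_ne_top_of_nonneg (by positivity) ?_))
    simp
  have hctop : D ^ θ * K ≠ ∞ :=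
    ENNReal.mul_ne_top (ENNReal.rpow_ne_top_of_nonneg hθ0.le hDtop) ENNReal.coe_ne_top
  refine ⟨max (D ^ θ * K).toNNReal (2 ^ s * 2), fun ν τ H hν hτ hν0 hν1 hτ0 hτ1 h hh hh0 hh1 => ?_⟩
  have P := H.isDualPair ha hb hν hτ hν0 hν1 hτ0 hτ1
  set U : (Fin d → ℝ) → ℝ≥0∞ := fun x => (ν x ^ a * τ x ^ b) ^ (1 / (a + b)) with hU
  obtain ⟨k, hk, hhk, hkint, hkM⟩ := exists_majorant hν hs (hC₁ volume ν τ U P)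
    (h := fun x => (h x / ν x) ^ (1 / s)) (by fun_prop)
  have hpow : ∀ x, ((h x / ν x) ^ (1 / s)) ^ s * ν x = h x := fun x => by
    rw [← ENNReal.rpow_mul, one_div_mul_cancel hs0.ne', ENNReal.rpow_one,
      ENNReal.div_mul_cancel (hν0 x) (hν1 x)]
  have hGint : ∫⁻ x, k x ^ s * ν x ≤ 2 ^ s * 2 := by
    refine hkint.trans ?_
    simp only [hpow]
    calc _ ≤ (2 : ℝ≥0∞) ^ s * 2 * 1 := by gcongr
      _ = _ := mul_one _
  have h2s : (2 : ℝ≥0∞) ^ s * 2 ≠ ∞ :=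
    ENNReal.mul_ne_top (ENNReal.rpow_ne_top_of_nonneg hs0.le (by simp)) (by simp)
  have hk0 : ∀ x, k x ≠ 0 := fun x hx => by
    have h1 := hhk x
    rw [hx, nonpos_iff_eq_zero, ENNReal.rpow_eq_zero_iff] at h1
    rcases h1 with h1 | h1
    · exact (ENNReal.div_ne_zero.2 ⟨hh0 x, hν1 x⟩) h1.1
    · linarith [h1.2, one_div_pos.2 hs0]
  have hkfin : ∀ᵐ x, k x ≠ ∞ := by
    have := ae_lt_top (μ := volume) (f := fun x => k x ^ s * ν x) (by fun_prop)
      (ne_top_of_le_ne_top h2s hGint)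
    filter_upwards [this] with x hx hx'
    rw [hx', ENNReal.top_rpow_of_pos hs0, ENNReal.top_mul (hν0 x)] at hx
    exact hx.ne rfl
  refine ⟨fun x => k x ^ s * ν x, by fun_prop, fun x => ?_, ?_, fun x r hr => ?_⟩
  · calc h x = ((h x / ν x) ^ (1 / s)) ^ s * ν x := (hpow x).symm
      _ ≤ k x ^ s * ν x := by
          gcongr
          exact hhk x
  · refine hGint.trans ?_
    have : (2 : ℝ≥0∞) ^ s * 2 = ((2 ^ s * 2 : ℝ≥0) : ℝ≥0∞) := by
      rw [ENNReal.coe_mul, ENNReal.coe_rpow_of_nonneg _ hs0.le]; norm_cast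
    rw [this]
    exact_mod_cast le_max_right _ _
  set B := Metric.closedBall x r with hB
  have hBm : MeasurableSet B := Metric.isClosed_closedBall.measurableSet
  set V := ∫⁻ y in B, U y with hV
  set N := ∫⁻ y in B, ν y with hN
  set T := ∫⁻ y in B, τ y with hT
  set κ := ∫⁻ y in B, k y * U y with hκ
  have hκle : ∀ y ∈ B, κ ≤ D * V * k y := fun y hy => by
    have := P.lintegral_mul_le_of_maxFn_le ha hb hk hkM x hr hy
    exact this
  have hVfin : V ≠ ∞ := P.lintegral_base_ne_top x r hr
  have hNfin : N ≠ ∞ := P.lintegral_left_ne_top x r hr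
  have hTfin : T ≠ ∞ := P.lintegral_right_ne_top x r hr
  have hN0 : N ≠ 0 := P.lintegral_left_ne_zero x r hr
  have hT0 : T ≠ 0 := P.lintegral_right_ne_zero x r hr
  have hUm := P.measurable_base
  have hUe : ∀ n t, (eexp n ^ a * eexp t ^ b) ^ (1 / (a + b)) = eexp ((n * a + t * b) / (a + b)) :=
    fun n t => by
      simp only [eexp_rpow, eexp_mul]
      rw [mul_one_div]
  have hκ0 : κ ≠ 0 := setLIntegral_ne_zero (by fun_prop)
    (fun y => mul_ne_zero (hk0 y) (P.base_ne_zero ha hb y)) (volume_closedBall_ne_zero x hr)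
  have hκ1 : κ ≠ ∞ := by
    have hne : (ae (volume.restrict B)).NeBot := by
      rw [ae_neBot, Ne, Measure.restrict_eq_zero]
      exact volume_closedBall_ne_zero x hr
    -- One point of the ball at which `k` is finite already bounds `κ`.
    obtain ⟨y, hy, hyB⟩ := ((ae_restrict_of_ae hkfin).and (ae_restrict_mem hBm)).exists
    exact ne_top_of_le_ne_top (ENNReal.mul_ne_top (ENNReal.mul_ne_top hDtop hVfin) hy)
      (hκle y hyB)
  have hleft : lpSize a₀ (fun y => ν y ^ a / (k y ^ s * ν y) ^ (a - a₀)) B ≤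
      (D * V / κ) ^ θ * N ^ a₀ := by
    -- The left side equals `k^(-θ) ν^a₀`, and `k⁻¹ ≤ D V / κ` on the ball.
    have hpt : ∀ᵐ y ∂(volume.restrict B), ν y ^ a / (k y ^ s * ν y) ^ (a - a₀) ≤
        (D * V / κ) ^ θ * ν y ^ a₀ := by
      filter_upwards [ae_restrict_of_ae hkfin, ae_restrict_mem hBm] with y hy hyB
      have h1 : (k y)⁻¹ ≤ D * V / κ := by
        rw [ENNReal.inv_le_iff_inv_le, ENNReal.inv_div (Or.inl hκ1) (Or.inl hκ0)]
        exact ENNReal.div_le_of_le_mul' (hκle y hyB)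
      have h2 : ν y ^ a / (k y ^ s * ν y) ^ (a - a₀) = (k y)⁻¹ ^ θ * ν y ^ a₀ := by
        obtain ⟨n, hn⟩ := exists_eq_eexp (hν0 y) (hν1 y)
        obtain ⟨c, hc⟩ := exists_eq_eexp (hk0 y) hy
        rw [hn, hc]
        simp only [eexp_rpow, eexp_mul, eexp_div, eexp_inv]
        congr 1
        rw [hθ]; ring
      rw [h2]
      gcongr
    rw [lpSize]
    split_ifs with h0
    · refine essSup_le_of_ae_le _ ?_
      filter_upwards [hpt] with y hy
      simpa [h0] using hy
    · have ha₀' : 0 < a₀ := lt_of_le_of_ne ha₀ (Ne.symm h0)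
      calc _ ≤ (∫⁻ y in B, ((D * V / κ) ^ θ * ν y ^ a₀) ^ (1 / a₀)) ^ a₀ := by
            refine ENNReal.rpow_le_rpow (lintegral_mono_ae ?_) ha₀
            filter_upwards [hpt] with y hy
            exact ENNReal.rpow_le_rpow hy (by positivity)
        _ = (∫⁻ y in B, ((D * V / κ) ^ θ) ^ (1 / a₀) * ν y) ^ a₀ := by
            congr 1
            refine lintegral_congr fun y => ?_
            rw [ENNReal.mul_rpow_of_nonneg _ _ (by positivity), ← ENNReal.rpow_mul (ν y),
              mul_one_div_cancel h0, ENNReal.rpow_one]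
        _ = _ := by
            rw [lintegral_const_mul _ hν, ENNReal.mul_rpow_of_nonneg _ _ ha₀,
              ← ENNReal.rpow_mul _ (1 / a₀), one_div_mul_cancel h0, ENNReal.rpow_one]
  have hexp : θ + b * a₀ / a = b₀ := by
    rw [hθ, hs_def]
    have : b₀ = a + b - a₀ := by linarith
    rw [this]
    field_simp
    ring
  have hba : 0 ≤ b * a₀ / a := by positivity
  -- The integrand before taking the power `1/b₀` is `(k U)^θ τ^(b a₀/a)`, and `hexp` says these
  -- exponents add up to `b₀`.
  have hright : lpSize b₀ (fun y => τ y ^ b * (k y ^ s * ν y) ^ (a - a₀)) B ≤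
      κ ^ θ * T ^ (b * a₀ / a) := by
    rw [lpSize, if_neg hb₀.ne']
    have := lintegral_rpow_mul_rpow_le (volume.restrict B) (f := fun y => k y * U y) (g := τ)
      (by fun_prop) hτ.aemeasurable hθ0.le hba (by rw [hexp]; exact hb₀)
    rw [hexp] at this
    refine le_trans (le_of_eq ?_) this
    congr 1
    refine lintegral_congr_ae ?_
    filter_upwards [ae_restrict_of_ae hkfin] with y hy
    congr 1
    obtain ⟨n, hn⟩ := exists_eq_eexp (hν0 y) (hν1 y)
    obtain ⟨t, ht⟩ := exists_eq_eexp (hτ0 y) (hτ1 y)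
    obtain ⟨c, hc⟩ := exists_eq_eexp (hk0 y) hy
    simp only [hU]
    rw [hn, ht, hc, hUe]
    simp only [eexp_rpow, eexp_mul]
    congr 1
    rw [hθ, hs_def]
    field_simp
    ring
  have hVNT : V ^ (a + b) ≤ N ^ a * T ^ b := P.lintegral_base_rpow_le ha hb _
  -- `κ^θ` cancels, and `V^(a+b) ≤ N^a T^b` restores the missing powers of `N` and `T`.
  have hprod : (D * V / κ) ^ θ * N ^ a₀ * (κ ^ θ * T ^ (b * a₀ / a)) ≤
      D ^ θ * (N ^ a * T ^ b) := by
    have h1 : V ^ θ ≤ (N ^ a * T ^ b) ^ ((a - a₀) / a) := by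
      have := ENNReal.rpow_le_rpow hVNT (z := (a - a₀) / a) (div_nonneg (by linarith) ha.le)
      rw [← ENNReal.rpow_mul] at this
      refine le_trans (le_of_eq ?_) this
      congr 1
      rw [hθ, hs_def]; ring
    have h2 : (D * V / κ) ^ θ * κ ^ θ = D ^ θ * V ^ θ := by
      rw [← ENNReal.mul_rpow_of_nonneg _ _ hθ0.le, ENNReal.div_mul_cancel hκ0 hκ1,
        ENNReal.mul_rpow_of_nonneg _ _ hθ0.le]
    have h3 : (N ^ a * T ^ b) ^ ((a - a₀) / a) * (N ^ a₀ * T ^ (b * a₀ / a)) = N ^ a * T ^ b := by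
      obtain ⟨n, hn⟩ := exists_eq_eexp hN0 hNfin
      obtain ⟨t, ht⟩ := exists_eq_eexp hT0 hTfin
      rw [hn, ht]
      simp only [eexp_rpow, eexp_mul]
      congr 1
      field_simp
      ring
    calc _ = ((D * V / κ) ^ θ * κ ^ θ) * (N ^ a₀ * T ^ (b * a₀ / a)) := by ring
      _ ≤ D ^ θ * (N ^ a * T ^ b) ^ ((a - a₀) / a) * (N ^ a₀ * T ^ (b * a₀ / a)) := by
          rw [h2]; gcongr
      _ = _ := by rw [mul_assoc, h3]
  calc _ ≤ ((D * V / κ) ^ θ * N ^ a₀) * (κ ^ θ * T ^ (b * a₀ / a)) *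
        (∫⁻ y in B, (ν y ^ a * τ y ^ b)⁻¹) := by gcongr
    _ ≤ D ^ θ * (N ^ a * T ^ b) * (∫⁻ y in B, (ν y ^ a * τ y ^ b)⁻¹) := by gcongr
    _ = D ^ θ * (N ^ a * T ^ b * (∫⁻ y in B, (ν y ^ a * τ y ^ b)⁻¹)) := by ring
    _ ≤ D ^ θ * (K * volume B ^ (a + b + 1)) := by gcongr _ * ?_; exact H x r hr
    _ = ((D ^ θ * K).toNNReal : ℝ≥0∞) * volume B ^ (a + b + 1) := by
        rw [ENNReal.coe_toNNReal hctop, mul_assoc]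
    _ ≤ _ := by
        gcongr
        exact le_max_left _ _

end WeightStep

/-! ### Translation of the weight constants: cubes are sup-norm balls, averages become integrals. -/

theorem cube_eq_closedBall {d : ℕ} (c : Fin d → ℝ) {r : ℝ} (hr : 0 ≤ r) :
    cube c r = Metric.closedBall c r := by
  ext x
  simp only [cube, mem_Icc, Pi.le_def, Metric.mem_closedBall, dist_pi_le_iff hr, Real.dist_eq,
    abs_le, ← forall_and]
  exact forall_congr' fun i => ⟨fun h => ⟨by linarith, by linarith⟩,
    fun h => ⟨by linarith, by linarith⟩⟩

theorem avgNorm_inv_ofReal {d : ℕ} {a : ℝ} (ha : 0 ≤ a) (f : (Fin d → ℝ) → ℝ≥0∞)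
    (c : Fin d → ℝ) {r : ℝ} (hr : 0 < r) : avgNorm (ENNReal.ofReal a)⁻¹ f (cube c r) =
      lpSize a f (Metric.closedBall c r) / volume (Metric.closedBall c r) ^ a := by
  rw [cube_eq_closedBall c hr.le, avgNorm, lpSize]
  rcases ha.eq_or_lt with rfl | ha'
  · simp
  · rw [if_neg (by simpa using ha'), if_neg ha'.ne', setLAverage_eq, ENNReal.toReal_inv,
      ENNReal.toReal_ofReal ha, one_div, inv_inv, ENNReal.div_rpow_of_nonneg _ _ ha, one_div]

theorem conjExponent_ofReal {p : ℝ} (hp : 1 ≤ p) :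
    (ENNReal.ofReal p).conjExponent = (ENNReal.ofReal (1 - 1 / p))⁻¹ := by
  rw [ENNReal.conjExponent]
  rcases hp.eq_or_lt with rfl | hp'
  · simp
  · have h1 : 0 < p - 1 := by linarith
    have h2 : 0 < 1 - 1 / p := by rw [sub_pos, div_lt_one (by linarith)]; exact hp'
    rw [← ENNReal.ofReal_one, ← ENNReal.ofReal_sub _ zero_le_one, ← ENNReal.ofReal_inv_of_pos h1,
      ← ENNReal.ofReal_inv_of_pos h2, ← ENNReal.ofReal_add zero_le_one (by positivity)]
    congr 1
    field_simp
    ring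

theorem partialConst₁_eq {d : ℕ} (u w : (Fin d → ℝ) → ℝ≥0∞) (p t : ℝ) :
    partialConst₁ u p t w = ⨆ (c : Fin d → ℝ) (r : ℝ) (_ : 0 < r),
      avgNorm (ENNReal.ofReal t) (fun x => w x * u x) (cube c r) *
        (avgNorm (ENNReal.ofReal p).conjExponent (fun x => (w x)⁻¹) (cube c r) *
          avgNorm 1 (fun x => (u x)⁻¹) (cube c r)) := by
  simp only [partialConst₁, partialConst, apqConst, Fin.prod_univ_castSucc, Fin.snoc_castSucc,
    Fin.snoc_last]
  simp [ENNReal.conjExponent]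

theorem memPartial₁_iff {d : ℕ} (u w : (Fin d → ℝ) → ℝ≥0∞) (p t : ℝ) :
    MemPartial₁ u p t w ↔ IsWeight w ∧ IsWeight u ∧ partialConst₁ u p t w < ∞ := by
  rw [MemPartial₁, MemPartial, MemApq, Fin.forall_fin_succ']
  simp only [Fin.snoc_castSucc, Fin.snoc_last, and_assoc]
  simp [partialConst₁, partialConst]

/-- The three normalising powers of the volume are collected on the right, in the form of
`JointBound`. -/
theorem partialConst₁_le_iff {d : ℕ} (u w : (Fin d → ℝ) → ℝ≥0∞) {p t : ℝ} (hp : 1 ≤ p)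
    (ht : 0 < t) (K : ℝ≥0∞) : partialConst₁ u p t w ≤ K ↔ ∀ (x : Fin d → ℝ) (r : ℝ), 0 < r →
      lpSize (1 / t) (fun y => w y * u y) (Metric.closedBall x r) *
      lpSize (1 - 1 / p) (fun y => (w y)⁻¹) (Metric.closedBall x r) *
      (∫⁻ y in Metric.closedBall x r, (u y)⁻¹) ≤
        K * volume (Metric.closedBall x r) ^ (1 / t + (1 - 1 / p) + 1) := by
  have hp' : 0 ≤ 1 - 1 / p := by rw [sub_nonneg, div_le_one (by linarith)]; exact hp
  have ht' : 0 < 1 / t := by positivity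
  rw [partialConst₁_eq]
  simp only [iSup_le_iff]
  refine forall_congr' fun c => forall_congr' fun r => forall_congr' fun hr => ?_
  have e1 : ENNReal.ofReal t = (ENNReal.ofReal (1 / t))⁻¹ := by
    rw [one_div, ENNReal.ofReal_inv_of_pos ht, inv_inv]
  have e2 : (1 : ℝ≥0∞) = (ENNReal.ofReal 1)⁻¹ := by simp
  rw [conjExponent_ofReal hp, e1, e2, avgNorm_inv_ofReal ht'.le _ _ hr,
    avgNorm_inv_ofReal hp' _ _ hr, avgNorm_inv_ofReal zero_le_one _ _ hr]
  obtain ⟨v, hv⟩ := exists_eq_eexp (volume_closedBall_ne_zero c hr) (volume_closedBall_ne_top c r)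
  have e3 : lpSize 1 (fun x => (u x)⁻¹) (Metric.closedBall c r) =
      ∫⁻ y in Metric.closedBall c r, (u y)⁻¹ := by simp [lpSize]
  rw [e3, hv]
  simp only [eexp_rpow, div_eq_mul_inv, eexp_inv]
  rw [← ENNReal.div_le_iff (eexp_ne_zero _) (eexp_ne_top _), div_eq_mul_inv, eexp_inv]
  rw [show -(v * (1 * t⁻¹ + (1 - 1 * p⁻¹) + 1)) =
    -(v * (1 * t⁻¹)) + (-(v * (1 - 1 * p⁻¹)) + -(v * 1)) by ring, ← eexp_mul, ← eexp_mul]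
  refine iff_of_eq (congrArg (· ≤ K) ?_)
  ring

/-! ### Inequalities for changing the exponent, and majorants. -/

section Hoelder

variable {α : Type*} [MeasurableSpace α] {μ : Measure α}

theorem lintegral_mul_rpow_le {X Y : α → ℝ≥0∞} (hX : AEMeasurable X μ) (hY : AEMeasurable Y μ)
    {q q₀ γ : ℝ} (hq₀ : 0 < q₀) (hγ : 0 ≤ γ) (h : 1 / q = 1 / q₀ + γ) :
    (∫⁻ x, (X x * Y x ^ γ) ^ q ∂μ) ^ (1 / q) ≤
      (∫⁻ x, X x ^ q₀ ∂μ) ^ (1 / q₀) * (∫⁻ x, Y x ∂μ) ^ γ := by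
  have hq0 : 0 < 1 / q₀ := by positivity
  have := lintegral_rpow_mul_rpow_le μ (hX.pow_const q₀) hY hq0.le hγ (by positivity)
  rw [← h] at this
  refine le_trans (le_of_eq ?_) this
  congr 1
  refine lintegral_congr fun x => ?_
  rw [← ENNReal.rpow_mul, mul_one_div_cancel hq₀.ne', ENNReal.rpow_one, one_div_one_div]

/-- Since `p/p₀ + pγ = 1`, write `X = X^(p/p₀) (X^p)^γ`; the bound by `c * G` lets `G^(-γ)` absorb
the second factor. -/
theorem lintegral_mul_rpow_neg_le {X G : α → ℝ≥0∞} (hX : AEMeasurable X μ)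
    (hG0 : ∀ᵐ x ∂μ, G x ≠ 0)
    (hG1 : ∀ᵐ x ∂μ, G x ≠ ∞) {c : ℝ≥0∞} {p p₀ γ : ℝ} (hp : 0 < p) (hp₀ : 0 < p₀) (hγ : 0 ≤ γ)
    (h : 1 / p = 1 / p₀ + γ) (hc : ∀ᵐ x ∂μ, X x ^ p ≤ c * G x) :
    (∫⁻ x, (X x * G x ^ (-γ)) ^ p₀ ∂μ) ^ (1 / p₀) ≤ c ^ γ * (∫⁻ x, X x ^ p ∂μ) ^ (1 / p₀) := by
  have e1 : p / p₀ + p * γ = 1 := by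
    field_simp at h ⊢
    linarith
  have hpt : ∀ᵐ x ∂μ, (X x * G x ^ (-γ)) ^ p₀ ≤ (c ^ γ) ^ p₀ * X x ^ p := by
    filter_upwards [hG0, hG1, hc] with x h0 h1 hx
    have h2 : X x = X x ^ (p / p₀) * (X x ^ p) ^ γ := by
      rw [← ENNReal.rpow_mul, ← ENNReal.rpow_add_of_nonneg _ _ (by positivity) (by positivity), e1,
        ENNReal.rpow_one]
    have h3 : X x * G x ^ (-γ) ≤ c ^ γ * X x ^ (p / p₀) := by
      calc X x * G x ^ (-γ) = X x ^ (p / p₀) * (X x ^ p) ^ γ * G x ^ (-γ) := by rw [← h2]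
        _ ≤ X x ^ (p / p₀) * (c * G x) ^ γ * G x ^ (-γ) := by gcongr
        _ = c ^ γ * X x ^ (p / p₀) * (G x ^ γ * G x ^ (-γ)) := by
            rw [ENNReal.mul_rpow_of_nonneg _ _ hγ]; ring
        _ = _ := by rw [← ENNReal.rpow_add _ _ h0 h1, add_neg_cancel, ENNReal.rpow_zero, mul_one]
    calc _ ≤ (c ^ γ * X x ^ (p / p₀)) ^ p₀ := by gcongr
      _ = _ := by
        rw [ENNReal.mul_rpow_of_nonneg _ _ hp₀.le, ← ENNReal.rpow_mul (X x),
          div_mul_cancel₀ _ hp₀.ne']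
  -- An infinite constant makes the claim trivial unless the integral on the right vanishes, and
  -- then `X = 0` almost everywhere.
  by_cases hctop : (c ^ γ) ^ p₀ = ∞
  · have hcγ : c ^ γ = ∞ := by
      by_contra hne
      exact ENNReal.rpow_ne_top_of_nonneg hp₀.le hne hctop
    rcases eq_or_ne (∫⁻ x, X x ^ p ∂μ) 0 with h0 | h0
    · have hX0 : ∀ᵐ x ∂μ, X x ^ p = 0 := (lintegral_eq_zero_iff' (hX.pow_const p)).1 h0
      have : ∫⁻ x, (X x * G x ^ (-γ)) ^ p₀ ∂μ = ∫⁻ _, 0 ∂μ := lintegral_congr_ae (by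
        filter_upwards [hX0] with x hx
        have hx' : X x = 0 := by simpa [hp, hp.not_gt] using hx
        simp [hx', hp₀])
      rw [this, lintegral_zero, ENNReal.zero_rpow_of_pos (by positivity)]
      exact zero_le
    · rw [hcγ, ENNReal.top_mul]
      · exact le_top
      · rw [Ne, ENNReal.rpow_eq_zero_iff]; rintro (h | h)
        · exact h0 h.1
        · linarith [h.2, one_div_pos.2 hp₀]
  calc _ ≤ (∫⁻ x, (c ^ γ) ^ p₀ * X x ^ p ∂μ) ^ (1 / p₀) :=
        ENNReal.rpow_le_rpow (lintegral_mono_ae hpt) (by positivity)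
    _ = _ := by
        rw [lintegral_const_mul' _ _ hctop, ENNReal.mul_rpow_of_nonneg _ _ (by positivity),
          ← ENNReal.rpow_mul _ p₀, mul_one_div_cancel hp₀.ne', ENNReal.rpow_one]

/-- The counterpart for a positive power of `G`: `X^(q/q₀) = X (X^q)^γ`, and `X^q` is replaced by `c
* G`. -/
theorem lintegral_rpow_le_lintegral_mul_rpow {X G : α → ℝ≥0∞} {c : ℝ≥0∞} {q q₀ γ : ℝ} (hq : 0 < q)
    (hq₀ : 0 < q₀) (hγ : 0 ≤ γ) (h : 1 / q₀ = 1 / q + γ) (hctop : c ≠ ∞)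
    (hc : ∀ᵐ x ∂μ, X x ^ q ≤ c * G x) :
    (∫⁻ x, X x ^ q ∂μ) ^ (1 / q₀) ≤ c ^ γ * (∫⁻ x, (X x * G x ^ γ) ^ q₀ ∂μ) ^ (1 / q₀) := by
  have e1 : q / q₀ = 1 + q * γ := by
    field_simp at h ⊢
    linarith
  have hpt : ∀ᵐ x ∂μ, X x ^ q ≤ (c ^ γ) ^ q₀ * (X x * G x ^ γ) ^ q₀ := by
    filter_upwards [hc] with x hx
    calc X x ^ q = (X x ^ (1 + q * γ)) ^ q₀ := by
          rw [← ENNReal.rpow_mul, ← e1, div_mul_cancel₀ _ hq₀.ne']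
      _ = (X x * (X x ^ q) ^ γ) ^ q₀ := by
          rw [ENNReal.rpow_add_of_nonneg _ _ zero_le_one (by positivity), ENNReal.rpow_one,
            ENNReal.rpow_mul]
      _ ≤ (X x * (c * G x) ^ γ) ^ q₀ := by gcongr
      _ = _ := by
          rw [ENNReal.mul_rpow_of_nonneg _ _ hγ, ← ENNReal.mul_rpow_of_nonneg _ _ hq₀.le]
          congr 1; ring
  have hctop' : (c ^ γ) ^ q₀ ≠ ∞ :=
    ENNReal.rpow_ne_top_of_nonneg hq₀.le (ENNReal.rpow_ne_top_of_nonneg hγ hctop)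
  calc _ ≤ (∫⁻ x, (c ^ γ) ^ q₀ * (X x * G x ^ γ) ^ q₀ ∂μ) ^ (1 / q₀) :=
        ENNReal.rpow_le_rpow (lintegral_mono_ae hpt) (by positivity)
    _ = _ := by
        rw [lintegral_const_mul' _ _ hctop', ENNReal.mul_rpow_of_nonneg _ _ (by positivity),
          ← ENNReal.rpow_mul _ q₀, mul_one_div_cancel hq₀.ne', ENNReal.rpow_one]

/-- The sum of the normalised functions with weights `2^(-(n+2))` has integral at most `1/2`. A
strictly positive function of integral below `1/2` is added so that `h` vanishes nowhere, which also
settles the case of an infinite integral. -/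
theorem exists_common_majorant [SigmaFinite μ] {F : ℕ → α → ℝ≥0∞}
    (hF : ∀ n, AEMeasurable (F n) μ) :
    ∃ h : α → ℝ≥0∞, Measurable h ∧ (∀ x, h x ≠ 0) ∧ ∫⁻ x, h x ∂μ ≤ 1 ∧
      ∀ n, ∀ᵐ x ∂μ, F n x ≤ 2 ^ (n + 2) * (∫⁻ x, F n x ∂μ) * h x := by
  obtain ⟨g, hg0, hgm, hg1⟩ := exists_pos_lintegral_lt_of_sigmaFinite μ
    (ε := 2⁻¹) (by simp)
  set S : ℕ → ℝ≥0∞ := fun n => ∫⁻ x, F n x ∂μ with hS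
  have hSmk : ∀ n, ∫⁻ x, (hF n).mk _ x ∂μ = S n := fun n =>
    lintegral_congr_ae (hF n).ae_eq_mk.symm
  have hmm : ∀ n, Measurable fun x => (2⁻¹ : ℝ≥0∞) ^ (n + 2) * (S n)⁻¹ * (hF n).mk _ x :=
    fun n => (hF n).measurable_mk.const_mul _
  refine ⟨fun x => g x + ∑' n, (2⁻¹ : ℝ≥0∞) ^ (n + 2) * (S n)⁻¹ * (hF n).mk _ x,
    ?_, fun x => ?_, ?_, fun n => ?_⟩
  · exact (measurable_coe_nnreal_ennreal.comp hgm).add (Measurable.tsum hmm)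
  · have := (hg0 x).ne'
    simp [this]
  · have hgm' : Measurable fun x => (g x : ℝ≥0∞) := by fun_prop
    rw [lintegral_add_left hgm', lintegral_tsum fun n => (hmm n).aemeasurable]
    calc _ ≤ (2⁻¹ : ℝ≥0∞) + ∑' n : ℕ, (2⁻¹ : ℝ≥0∞) ^ (n + 2) := by
          gcongr with n
          rw [lintegral_const_mul _ (hF n).measurable_mk, hSmk, mul_assoc]
          exact mul_le_of_le_one_right' (ENNReal.inv_mul_le_one _)
      _ = 1 := by
          simp_rw [pow_add]
          rw [ENNReal.tsum_mul_right, ENNReal.tsum_geometric, ENNReal.one_sub_inv_two, inv_inv,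
            sq, ← mul_assoc, ENNReal.mul_inv_cancel (by simp) (by simp), one_mul,
            ENNReal.inv_two_add_inv_two]
  · rcases eq_or_ne (S n) 0 with h0 | h0
    · have : F n =ᵐ[μ] 0 := (lintegral_eq_zero_iff' (hF n)).1 h0
      filter_upwards [this] with x hx
      simp [hx]
    rcases eq_or_ne (S n) ∞ with h1 | h1
    · refine Filter.Eventually.of_forall fun x => ?_
      have : (2 : ℝ≥0∞) ^ (n + 2) * ∞ = ∞ := ENNReal.mul_top (by simp)
      have hS' : ∫⁻ x, F n x ∂μ = ∞ := h1
      rw [hS', this, ENNReal.top_mul]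
      · exact le_top
      · have := (hg0 x).ne'
        simp [this]
    filter_upwards [(hF n).ae_eq_mk] with x hx
    calc F n x = (2 ^ (n + 2) * (2⁻¹ : ℝ≥0∞) ^ (n + 2)) * (S n * (S n)⁻¹) * (hF n).mk _ x := by
          rw [← mul_pow, ENNReal.mul_inv_cancel (by simp) (by simp),
            ENNReal.mul_inv_cancel h0 h1, one_pow, one_mul, one_mul, hx]
      _ = 2 ^ (n + 2) * S n * ((2⁻¹ : ℝ≥0∞) ^ (n + 2) * (S n)⁻¹ * (hF n).mk _ x) := by ring
      _ ≤ _ := by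
          gcongr
          exact (ENNReal.le_tsum n).trans le_add_self

/-- The lower integral is a supremum over simple functions, so `f` need not be measurable;
σ-finiteness then truncates to finite integral. -/
theorem exists_le_lintegral_lt_top [SigmaFinite μ] {f : α → ℝ≥0∞} {c : ℝ≥0∞}
    (h : c < ∫⁻ x, f x ∂μ) :
    ∃ g : α → ℝ≥0∞, Measurable g ∧ (∀ x, g x ≤ f x) ∧ ∫⁻ x, g x ∂μ < ∞ ∧ c < ∫⁻ x, g x ∂μ := by
  simp_rw [lintegral_eq_nnreal, lt_iSup_iff] at h
  obtain ⟨g₀, hg₀, hc⟩ := h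
  have h' : c < ∫⁻ x, g₀ x ∂μ := by
    convert! hc
    rw [← SimpleFunc.lintegral_eq_lintegral, SimpleFunc.coe_map]
    simp only [Function.comp_apply]
  obtain ⟨g, hg, h1, h2⟩ := SimpleFunc.exists_lt_lintegral_simpleFunc_of_lt_lintegral h'
  exact ⟨fun x => g x, measurable_coe_nnreal_ennreal.comp g.measurable,
    fun x => (ENNReal.coe_le_coe.2 (hg x)).trans (hg₀ x), h1, h2⟩

end Hoelder

/-! ### Construction of the weight and the extrapolation argument. -/

section Extrapolation

variable {d : ℕ}

theorem IsWeight.exists_measurable {w : (Fin d → ℝ) → ℝ≥0∞} (hw : IsWeight w) :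
    ∃ w' : (Fin d → ℝ) → ℝ≥0∞, Measurable w' ∧ (∀ x, w' x ≠ 0) ∧ (∀ x, w' x ≠ ∞) ∧
      ∀ᵐ x, w x = w' x := by
  obtain ⟨hm, h0⟩ := hw
  have hs : MeasurableSet {x | 0 < hm.mk w x ∧ hm.mk w x < ∞} :=
    (measurableSet_lt measurable_const hm.measurable_mk).inter
      (measurableSet_lt hm.measurable_mk measurable_const)
  classical
  refine ⟨fun x => if 0 < hm.mk w x ∧ hm.mk w x < ∞ then hm.mk w x else 1,
    Measurable.ite hs hm.measurable_mk measurable_const, fun x => ?_, fun x => ?_, ?_⟩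
  · dsimp only
    split_ifs with h
    · exact h.1.ne'
    · exact one_ne_zero
  · dsimp only
    split_ifs with h
    · exact h.2.ne
    · exact ENNReal.one_ne_top
  · filter_upwards [hm.ae_eq_mk, h0] with x hx h0x
    rw [hx] at h0x
    rw [if_pos h0x, hx]

theorem lpSize_congr_ae {a : ℝ} {f g : (Fin d → ℝ) → ℝ≥0∞} (h : ∀ᵐ x, f x = g x)
    (Q : Set (Fin d → ℝ)) : lpSize a f Q = lpSize a g Q := by
  have h' : f =ᵐ[volume.restrict Q] g := ae_restrict_of_ae h
  rw [lpSize, lpSize, essSup_congr_ae h']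
  congr 2
  refine lintegral_congr_ae ?_
  filter_upwards [h'] with x hx
  rw [hx]

theorem JointBound.symm {a b : ℝ} {K : ℝ≥0∞} {ν τ : (Fin d → ℝ) → ℝ≥0∞}
    (h : JointBound a b K ν τ) : JointBound b a K τ ν := fun x r hr => by
  have := h x r hr
  rw [add_comm b a]
  simp_rw [mul_comm (τ _ ^ b)]
  rwa [mul_comm ((∫⁻ y in Metric.closedBall x r, τ y) ^ b)]

/-- Any `h` of integral at most `1` has a majorant `G` of bounded integral, a power of which carries
`v ∈ A^u_{p,t}` into `A^u_{p₀,t₀}`. -/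
theorem exists_partial_weight {p t p₀ t₀ : ℝ} (hp : 1 < p) (ht : 0 < t) (hp₀ : 1 ≤ p₀)
    (ht₀ : 0 < t₀) (hpt : 1 / p - 1 / p₀ = 1 / t - 1 / t₀) (K : ℝ≥0) :
    ∃ C : ℝ≥0, ∀ u v : (Fin d → ℝ) → ℝ≥0∞, MemPartial₁ u p t v → partialConst₁ u p t v ≤ K →
      ∀ h : (Fin d → ℝ) → ℝ≥0∞, Measurable h → (∀ x, h x ≠ 0) → ∫⁻ x, h x ≤ 1 →
      ∃ G : (Fin d → ℝ) → ℝ≥0∞, Measurable G ∧ (∀ x, h x ≤ G x) ∧ ∫⁻ x, G x ≤ C ∧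
        MemPartial₁ u p₀ t₀ (fun x => v x * G x ^ (1 / p₀ - 1 / p)) ∧
        partialConst₁ u p₀ t₀ (fun x => v x * G x ^ (1 / p₀ - 1 / p)) ≤ C := by
  set γ := 1 / p₀ - 1 / p with hγ
  set a := 1 / t with ha_def
  set b := 1 - 1 / p with hb_def
  set a₀ := 1 / t₀ with ha₀_def
  set b₀ := 1 - 1 / p₀ with hb₀_def
  have ha : 0 < a := by positivity
  have ha₀ : 0 < a₀ := by positivity
  have hb : 0 < b := by rw [hb_def, sub_pos, div_lt_one (by linarith)]; exact hp
  have hb₀ : 0 ≤ b₀ := by rw [hb₀_def, sub_nonneg, div_le_one (by linarith)]; exact hp₀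
  have hab : a + b = a₀ + b₀ := by linarith
  have hγa : a - a₀ = -γ := by linarith
  have hγb : b - b₀ = γ := by linarith
  -- Reduction to measurable representatives that are nowhere `0` or `∞`; the constants see weights
  -- only up to null sets.
  suffices key : ∃ C : ℝ≥0, ∀ u v : (Fin d → ℝ) → ℝ≥0∞, Measurable u → Measurable v →
      (∀ x, u x ≠ 0) → (∀ x, u x ≠ ∞) → (∀ x, v x ≠ 0) → (∀ x, v x ≠ ∞) →
      JointBound a b K (fun x => (v x * u x) ^ (1 / a)) (fun x => (v x)⁻¹ ^ (1 / b)) →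
      ∀ h : (Fin d → ℝ) → ℝ≥0∞, Measurable h → (∀ x, h x ≠ 0) → ∫⁻ x, h x ≤ 1 →
      ∃ G : (Fin d → ℝ) → ℝ≥0∞, Measurable G ∧ (∀ x, h x ≤ G x) ∧ ∫⁻ x, G x ≤ C ∧
        ∀ (x : Fin d → ℝ) (r : ℝ), 0 < r →
          lpSize a₀ (fun y => v y * G y ^ γ * u y) (Metric.closedBall x r) *
          lpSize b₀ (fun y => (v y * G y ^ γ)⁻¹) (Metric.closedBall x r) *
          (∫⁻ y in Metric.closedBall x r, (u y)⁻¹) ≤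
            C * volume (Metric.closedBall x r) ^ (a₀ + b₀ + 1) by
    obtain ⟨C, hC⟩ := key
    refine ⟨C, fun u v hv hK h hh hh0 hh1 => ?_⟩
    obtain ⟨hvw, huw, -⟩ := (memPartial₁_iff _ _ _ _).1 hv
    obtain ⟨u', hum, hu0, hu1, hu⟩ := huw.exists_measurable
    obtain ⟨v', hvm, hv0, hv1, hv⟩ := hvw.exists_measurable
    have hB : JointBound a b K (fun x => (v' x * u' x) ^ (1 / a))
        (fun x => (v' x)⁻¹ ^ (1 / b)) := by
      intro x r hr
      have h1 := (partialConst₁_le_iff u v hp.le ht K).1 hK x r hr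
      rw [← ha_def, ← hb_def, lpSize_congr_ae (f := fun y => v y * u y) (g := fun y => v' y * u' y)
        (by filter_upwards [hu, hv] with y h1 h2; rw [h1, h2]),
        lpSize_congr_ae (f := fun y => (v y)⁻¹) (g := fun y => (v' y)⁻¹)
        (by filter_upwards [hv] with y h2; rw [h2]),
        lpSize, lpSize, if_neg ha.ne', if_neg hb.ne'] at h1
      refine le_trans (le_of_eq ?_) h1
      congr 1
      refine lintegral_congr_ae (ae_restrict_of_ae ?_)
      filter_upwards [hu] with y hy
      rw [← ENNReal.rpow_mul, ← ENNReal.rpow_mul, one_div_mul_cancel ha.ne',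
        one_div_mul_cancel hb.ne', ENNReal.rpow_one, ENNReal.rpow_one, mul_right_comm,
        ENNReal.mul_inv_cancel (hv0 y) (hv1 y), one_mul, hy]
    obtain ⟨G, hG, hhG, hG1, hGw⟩ := hC u' v' hum hvm hu0 hu1 hv0 hv1 hB h hh hh0 hh1
    have hle : partialConst₁ u p₀ t₀ (fun x => v x * G x ^ γ) ≤ C := by
      rw [partialConst₁_le_iff _ _ hp₀ ht₀]
      intro x r hr
      rw [← ha₀_def, ← hb₀_def]
      convert! hGw x r hr using 1
      congr 1
      · congr 1
        · exact lpSize_congr_ae (by filter_upwards [hu, hv] with y h1 h2; rw [h1, h2]) _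
        · exact lpSize_congr_ae (by filter_upwards [hv] with y h1; rw [h1]) _
      · refine lintegral_congr_ae (ae_restrict_of_ae ?_)
        filter_upwards [hu] with y hy
        rw [hy]
    refine ⟨G, hG, hhG, hG1, (memPartial₁_iff _ _ _ _).2 ⟨⟨?_, ?_⟩, huw, ?_⟩, hle⟩
    · exact hvw.1.mul (hG.pow_const γ).aemeasurable
    · have hGfin := ae_lt_top hG (ne_top_of_le_ne_top ENNReal.coe_ne_top hG1)
      filter_upwards [hvw.2, hGfin] with x hx hGx
      have hG0 : G x ≠ 0 := fun h0 => hh0 x (by simpa [h0] using hhG x)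
      refine ⟨ENNReal.mul_pos hx.1.ne' (ENNReal.rpow_pos (pos_iff_ne_zero.2 hG0) hGx.ne).ne',
        ENNReal.mul_lt_top hx.2 ((ENNReal.rpow_ne_top_of_ne_zero hG0 hGx.ne).lt_top)⟩
    · exact hle.trans_lt ENNReal.coe_lt_top
  have hνa : ∀ (u v : (Fin d → ℝ) → ℝ≥0∞) x, ((v x * u x) ^ (1 / a)) ^ a = v x * u x :=
    fun u v x => by rw [← ENNReal.rpow_mul, one_div_mul_cancel ha.ne', ENNReal.rpow_one]
  have hτb : ∀ (v : (Fin d → ℝ) → ℝ≥0∞) x, ((v x)⁻¹ ^ (1 / b)) ^ b = (v x)⁻¹ :=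
    fun v x => by rw [← ENNReal.rpow_mul, one_div_mul_cancel hb.ne', ENNReal.rpow_one]
  have hu_eq : ∀ (u v : (Fin d → ℝ) → ℝ≥0∞) x, v x ≠ 0 → v x ≠ ∞ → v x * u x * (v x)⁻¹ = u x :=
    fun u v x h0 h1 => by
      rw [mul_right_comm, ENNReal.mul_inv_cancel h0 h1, one_mul]
  have hinv : ∀ (v G : (Fin d → ℝ) → ℝ≥0∞) x, v x ≠ 0 → v x ≠ ∞ →
      (v x * G x ^ γ)⁻¹ = (v x)⁻¹ * G x ^ (-γ) := fun v G x h0 h1 => by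
    rw [ENNReal.mul_inv (Or.inl h0) (Or.inl h1), ENNReal.rpow_neg]
  have hpos : ∀ {x : ℝ≥0∞} {e : ℝ}, x ≠ 0 → x ≠ ∞ → x ^ e ≠ 0 ∧ x ^ e ≠ ∞ := fun h0 h1 =>
    ⟨(ENNReal.rpow_pos (pos_iff_ne_zero.2 h0) h1).ne', ENNReal.rpow_ne_top_of_ne_zero h0 h1⟩
  -- The larger of `a, a₀` or of `b, b₀` decides which density is `ν`: `(uv)^t` if `γ < 0`,
  -- `v^(-p')` if `γ > 0`. For `γ = 0` nothing changes and `G = h`.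
  rcases lt_trichotomy γ 0 with hneg | hzero | hpos'
  · obtain ⟨C, hC⟩ := exists_joint_weight (d := d) ha hb ha₀.le (by linarith : 0 < b₀)
      (by linarith : a₀ < a) hab K
    refine ⟨C, fun u v hu hv hu0 hu1 hv0 hv1 hB h hh hh0 hh1 => ?_⟩
    have hvu0 : ∀ x, v x * u x ≠ 0 := fun x => mul_ne_zero (hv0 x) (hu0 x)
    have hvu1 : ∀ x, v x * u x ≠ ∞ := fun x => ENNReal.mul_ne_top (hv1 x) (hu1 x)
    have hvi0 : ∀ x, (v x)⁻¹ ≠ 0 := fun x => by simpa using hv1 x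
    have hvi1 : ∀ x, (v x)⁻¹ ≠ ∞ := fun x => by simpa using hv0 x
    obtain ⟨G, hG, hhG, hG1, hGw⟩ := hC _ _ hB (by fun_prop) (by fun_prop)
      (fun x => (hpos (hvu0 x) (hvu1 x)).1) (fun x => (hpos (hvu0 x) (hvu1 x)).2)
      (fun x => (hpos (hvi0 x) (hvi1 x)).1) (fun x => (hpos (hvi0 x) (hvi1 x)).2) h hh hh0 hh1
    refine ⟨G, hG, hhG, hG1, fun x r hr => ?_⟩
    have := hGw x r hr
    simp only [hνa, hτb, hγa] at this
    rw [← hab]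
    refine le_trans (le_of_eq (congrArg₂ _ (congrArg₂ _
      (lpSize_congr_ae (Filter.Eventually.of_forall fun y => ?_) _)
      (lpSize_congr_ae (Filter.Eventually.of_forall fun y => ?_) _))
      (lintegral_congr fun y => ?_))) this
    · rw [ENNReal.rpow_neg, div_eq_mul_inv, inv_inv, mul_right_comm]
    · exact hinv v G y (hv0 y) (hv1 y)
    · rw [hu_eq u v y (hv0 y) (hv1 y)]
  · refine ⟨max K 1, fun u v hu hv hu0 hu1 hv0 hv1 hB h hh hh0 hh1 => ⟨h, hh, fun _ => le_rfl,
      hh1.trans ?_, fun x r hr => ?_⟩⟩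
    · exact_mod_cast le_max_right _ _
    · have h1 := hB x r hr
      simp only [hνa, hτb] at h1
      have e1 : a₀ = a := by linarith
      have e2 : b₀ = b := by linarith
      rw [lpSize, lpSize, e1, e2, if_neg ha.ne', if_neg hb.ne']
      simp only [hzero, ENNReal.rpow_zero, mul_one]
      calc _ = (∫⁻ y in Metric.closedBall x r, (v y * u y) ^ (1 / a)) ^ a *
            (∫⁻ y in Metric.closedBall x r, (v y)⁻¹ ^ (1 / b)) ^ b *
            ∫⁻ y in Metric.closedBall x r, (v y * u y * (v y)⁻¹)⁻¹ := by
              congr 1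
              refine lintegral_congr fun y => ?_
              rw [hu_eq u v y (hv0 y) (hv1 y)]
        _ ≤ _ := h1
        _ ≤ _ := by
          gcongr
          exact le_max_left _ _
  · obtain ⟨C, hC⟩ := exists_joint_weight (d := d) hb ha hb₀ ha₀
      (by linarith : b₀ < b) (by linarith : b + a = b₀ + a₀) K
    refine ⟨C, fun u v hu hv hu0 hu1 hv0 hv1 hB h hh hh0 hh1 => ?_⟩
    have hvu0 : ∀ x, v x * u x ≠ 0 := fun x => mul_ne_zero (hv0 x) (hu0 x)
    have hvu1 : ∀ x, v x * u x ≠ ∞ := fun x => ENNReal.mul_ne_top (hv1 x) (hu1 x)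
    have hvi0 : ∀ x, (v x)⁻¹ ≠ 0 := fun x => by simpa using hv1 x
    have hvi1 : ∀ x, (v x)⁻¹ ≠ ∞ := fun x => by simpa using hv0 x
    obtain ⟨G, hG, hhG, hG1, hGw⟩ := hC _ _ hB.symm (by fun_prop) (by fun_prop)
      (fun x => (hpos (hvi0 x) (hvi1 x)).1) (fun x => (hpos (hvi0 x) (hvi1 x)).2)
      (fun x => (hpos (hvu0 x) (hvu1 x)).1) (fun x => (hpos (hvu0 x) (hvu1 x)).2) h hh hh0 hh1
    refine ⟨G, hG, hhG, hG1, fun x r hr => ?_⟩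
    have := hGw x r hr
    simp only [hνa, hτb, hγb] at this
    rw [← hab, add_comm a b, mul_comm (lpSize a₀ _ _)]
    refine le_trans (le_of_eq (congrArg₂ _ (congrArg₂ _
      (lpSize_congr_ae (Filter.Eventually.of_forall fun y => ?_) _)
      (lpSize_congr_ae (Filter.Eventually.of_forall fun y => ?_) _))
      (lintegral_congr fun y => ?_))) this
    · rw [hinv v G y (hv0 y) (hv1 y), ENNReal.rpow_neg, div_eq_mul_inv]
    · rw [mul_right_comm]
    · rw [mul_comm, hu_eq u v y (hv0 y) (hv1 y)]

theorem weightedNorm_eq {s : ℝ} (hs : 0 < s) (h w : (Fin d → ℝ) → ℝ≥0∞) :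
    weightedNorm s h w = (∫⁻ x, (h x * w x) ^ s) ^ (1 / s) := by
  simp only [weightedNorm, ENNReal.mul_rpow_of_nonneg _ _ hs.le]

/-- One weight `w` serves all pairs of the sequence at once, while `K₀` and `B` are fixed before the
weights and the sequence. The loss `B n` grows with `n` but not with the data, which is what the
diagonal argument needs. -/
theorem exists_weight_forall_weightedNorm_le {p q t p₀ q₀ t₀ : ℝ} (hp : 1 < p) (hq : 0 < q)
    (ht : 0 < t) (hp₀ : 1 ≤ p₀) (hq₀ : 0 < q₀) (ht₀ : 0 < t₀)
    (hpq : 1 / p - 1 / p₀ = 1 / q - 1 / q₀) (hpt : 1 / p - 1 / p₀ = 1 / t - 1 / t₀) (K : ℝ≥0) :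
    ∃ (K₀ : ℝ≥0) (B : ℕ → ℝ≥0), ∀ u v : (Fin d → ℝ) → ℝ≥0∞, MemPartial₁ u p t v →
      partialConst₁ u p t v ≤ K → ∀ g f : ℕ → (Fin d → ℝ) → ℝ≥0∞, (∀ n, AEMeasurable (g n)) →
      (∀ n, AEMeasurable (f n)) → (∀ n, weightedNorm q (g n) v ≠ ∞) →
      ∃ w, MemPartial₁ u p₀ t₀ w ∧ partialConst₁ u p₀ t₀ w ≤ K₀ ∧ ∀ (n : ℕ) (C : ℝ≥0),
        weightedNorm q₀ (g n) w ≤ C * weightedNorm p₀ (f n) w →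
          weightedNorm q (g n) v ≤ B n * C * weightedNorm p (f n) v := by
  have hp0 : 0 < p := by linarith
  have hp₀0 : 0 < p₀ := by linarith
  obtain ⟨K₀, hK₀⟩ := exists_partial_weight (d := d) hp ht hp₀ ht₀ hpt K
  set γ := 1 / p₀ - 1 / p with hγ
  have coe : ∀ (n : ℕ) {e : ℝ}, 0 ≤ e → (((2 ^ (n + 2) * K₀) ^ e : ℝ≥0) : ℝ≥0∞) =
      (2 ^ (n + 2)) ^ e * (K₀ : ℝ≥0∞) ^ e := fun n e he => by
    rw [ENNReal.coe_rpow_of_nonneg _ he, ENNReal.coe_mul, ENNReal.mul_rpow_of_nonneg _ _ he]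
    push_cast
    rfl
  have facts : ∀ {G : (Fin d → ℝ) → ℝ≥0∞}, Measurable G → ∫⁻ x, G x ≤ K₀ → (∀ x, G x ≠ 0) →
      (∀ᵐ x, G x ≠ ∞) ∧ ∀ (h v : (Fin d → ℝ) → ℝ≥0∞) (e s : ℝ),
        ∫⁻ x, (h x * v x) ^ s = ∫⁻ x, (h x * (v x * G x ^ e) * G x ^ (-e)) ^ s := by
    intro G hG hG1 hG0
    have hfin : ∀ᵐ x, G x ≠ ∞ := by
      filter_upwards [ae_lt_top hG (ne_top_of_le_ne_top ENNReal.coe_ne_top hG1)] with x hx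
      exact hx.ne
    refine ⟨hfin, fun h v e s => lintegral_congr_ae ?_⟩
    filter_upwards [hfin] with x hx
    rw [mul_assoc, mul_assoc, ← ENNReal.rpow_add _ _ (hG0 x) hx, add_neg_cancel, ENNReal.rpow_zero,
      mul_one]
  -- For `γ ≤ 0`, `g` is handled by Hölder and `f` through `(f v)^p ≲ G`. For `γ ≥ 0` the roles of
  -- `f` and `g` are exchanged.
  rcases le_total γ 0 with hγ0 | hγ0
  · refine ⟨K₀, fun n => (2 ^ (n + 2) * K₀) ^ (-γ), fun u v hv hK g f hg hf _ => ?_⟩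
    have hvm : AEMeasurable v := ((memPartial₁_iff _ _ _ _).1 hv).1.1
    obtain ⟨h, hh, hh0, hh1, hfh⟩ := exists_common_majorant (μ := (volume : Measure (Fin d → ℝ)))
      (F := fun n x => (f n x * v x) ^ p) (fun n => ((hf n).mul hvm).pow_const p)
    obtain ⟨G, hG, hhG, hG1, hw, hwK⟩ := hK₀ u v hv hK h hh hh0 hh1
    have hG0 : ∀ x, G x ≠ 0 := fun x h0 => hh0 x (by simpa [h0] using hhG x)
    obtain ⟨hGfin, hGeq⟩ := facts hG hG1 hG0
    refine ⟨_, hw, hwK, fun n C hgf => ?_⟩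
    set w : (Fin d → ℝ) → ℝ≥0∞ := fun x => v x * G x ^ γ with hw_def
    have hwm : AEMeasurable w := hvm.mul (hG.pow_const γ).aemeasurable
    set S := ∫⁻ x, (f n x * v x) ^ p
    have h1 : weightedNorm q (g n) v ≤ weightedNorm q₀ (g n) w * K₀ ^ (-γ) := by
      rw [weightedNorm_eq hq, weightedNorm_eq hq₀, hGeq _ _ γ]
      refine (lintegral_mul_rpow_le (X := fun x => g n x * w x) ((hg n).mul hwm)
        hG.aemeasurable hq₀ (by linarith) (by linarith)).trans ?_
      exact mul_le_mul_right (ENNReal.rpow_le_rpow hG1 (by linarith)) _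
    have h2 : weightedNorm p₀ (f n) w ≤ (2 ^ (n + 2)) ^ (-γ) * weightedNorm p (f n) v := by
      rw [weightedNorm_eq hp0, weightedNorm_eq hp₀0]
      have := lintegral_mul_rpow_neg_le (γ := -γ) (c := 2 ^ (n + 2) * S)
        (X := fun x => f n x * v x) ((hf n).mul hvm)
        (Filter.Eventually.of_forall hG0) hGfin hp0 hp₀0 (by linarith) (by linarith) (by
          filter_upwards [hfh n] with x hx
          refine hx.trans ?_
          gcongr
          exact hhG x)
      rw [neg_neg] at this
      simp only [hw_def, ← mul_assoc]
      refine this.trans (le_of_eq ?_)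
      rw [ENNReal.mul_rpow_of_nonneg _ _ (by linarith), mul_assoc,
        ← ENNReal.rpow_add_of_nonneg _ _ (by linarith) (by positivity)]
      congr 2
      linarith
    calc weightedNorm q (g n) v ≤ weightedNorm q₀ (g n) w * K₀ ^ (-γ) := h1
      _ ≤ (C * ((2 ^ (n + 2)) ^ (-γ) * weightedNorm p (f n) v)) * K₀ ^ (-γ) := by
          gcongr
          refine hgf.trans ?_
          gcongr
      _ = _ := by
          rw [coe n (by linarith)]
          ring
  · refine ⟨K₀, fun n => (2 ^ (n + 2) * K₀) ^ γ, fun u v hv hK g f hg hf hgfin => ?_⟩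
    have hvm : AEMeasurable v := ((memPartial₁_iff _ _ _ _).1 hv).1.1
    obtain ⟨h, hh, hh0, hh1, hgh⟩ := exists_common_majorant (μ := (volume : Measure (Fin d → ℝ)))
      (F := fun n x => (g n x * v x) ^ q) (fun n => ((hg n).mul hvm).pow_const q)
    obtain ⟨G, hG, hhG, hG1, hw, hwK⟩ := hK₀ u v hv hK h hh hh0 hh1
    refine ⟨_, hw, hwK, fun n C hgf => ?_⟩
    set w : (Fin d → ℝ) → ℝ≥0∞ := fun x => v x * G x ^ γ with hw_def
    set S := ∫⁻ x, (g n x * v x) ^ q with hS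
    have hgn := hgfin n
    rw [weightedNorm_eq hq] at hgn ⊢
    rw [← hS] at hgn ⊢
    have hStop : S ≠ ∞ := fun h => hgn (by rw [h, ENNReal.top_rpow_of_pos (by positivity)])
    rcases eq_or_ne S 0 with hS0 | hS0
    · rw [hS0, ENNReal.zero_rpow_of_pos (by positivity)]
      exact zero_le
    have h1 : S ^ (1 / q₀) ≤ (2 ^ (n + 2) * S) ^ γ * weightedNorm q₀ (g n) w := by
      have := lintegral_rpow_le_lintegral_mul_rpow (γ := γ) (c := 2 ^ (n + 2) * S)
        (X := fun x => g n x * v x) (G := G) (μ := (volume : Measure (Fin d → ℝ))) hq hq₀ hγ0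
        (by linarith) (ENNReal.mul_ne_top (by finiteness) hStop) (by
          filter_upwards [hgh n] with x hx
          refine hx.trans ?_
          gcongr
          exact hhG x)
      rw [weightedNorm_eq hq₀]
      simp only [hw_def, ← mul_assoc]
      exact this
    have h2 : weightedNorm p₀ (f n) w ≤ weightedNorm p (f n) v * K₀ ^ γ := by
      rw [weightedNorm_eq hp0, weightedNorm_eq hp₀0]
      simp only [hw_def, ← mul_assoc]
      refine (lintegral_mul_rpow_le (X := fun x => f n x * v x) ((hf n).mul hvm)
        hG.aemeasurable hp0 hγ0 (by linarith)).trans ?_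
      gcongr
    have hSγ0 : S ^ γ ≠ 0 := (ENNReal.rpow_pos (pos_iff_ne_zero.2 hS0) hStop).ne'
    have hSγ1 : S ^ γ ≠ ∞ := ENNReal.rpow_ne_top_of_nonneg hγ0 hStop
    -- `S^γ` occurs on both sides and is cancelled; this is where finiteness of the norm of `g n` is
    -- needed.
    rw [← ENNReal.mul_le_mul_iff_left hSγ0 hSγ1,
      ← ENNReal.rpow_add_of_nonneg _ _ (by positivity) hγ0,
      show 1 / q + γ = 1 / q₀ by linarith]
    calc S ^ (1 / q₀) ≤ (2 ^ (n + 2) * S) ^ γ * weightedNorm q₀ (g n) w := h1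
      _ ≤ (2 ^ (n + 2) * S) ^ γ * (C * (weightedNorm p (f n) v * K₀ ^ γ)) := by
          gcongr
          refine hgf.trans ?_
          gcongr
      _ = _ := by
          rw [coe n hγ0, ENNReal.mul_rpow_of_nonneg _ _ hγ0]
          ring

/-- A failed inequality persists after truncating `g` to finite norm: truncate `(g v)^q`, then undo
the power and the weight. -/
theorem exists_le_weightedNorm_ne_top {q : ℝ} (hq : 0 < q) {g v : (Fin d → ℝ) → ℝ≥0∞}
    (hv : IsWeight v) {c : ℝ≥0∞} (h : c < weightedNorm q g v) :
    ∃ g' : (Fin d → ℝ) → ℝ≥0∞, AEMeasurable g' ∧ (∀ᵐ x, g' x ≤ g x) ∧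
      weightedNorm q g' v ≠ ∞ ∧ c < weightedNorm q g' v := by
  rw [weightedNorm_eq hq, one_div, ENNReal.lt_rpow_inv_iff hq] at h
  obtain ⟨φ, hφ, hφle, hφ1, hφ2⟩ := exists_le_lintegral_lt_top h
  have hq' : 0 < 1 / q := by positivity
  have heq : weightedNorm q (fun x => φ x ^ (1 / q) / v x) v = (∫⁻ x, φ x) ^ (1 / q) := by
    rw [weightedNorm_eq hq]
    congr 1
    refine lintegral_congr_ae ?_
    filter_upwards [hv.2] with x hx
    rw [ENNReal.div_mul_cancel hx.1.ne' hx.2.ne, ← ENNReal.rpow_mul, one_div_mul_cancel hq.ne',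
      ENNReal.rpow_one]
  refine ⟨fun x => φ x ^ (1 / q) / v x, (hφ.pow_const _).aemeasurable.div hv.1, ?_, ?_, ?_⟩
  · filter_upwards [hv.2] with x hx
    rw [ENNReal.div_le_iff hx.1.ne' hx.2.ne, one_div, ENNReal.rpow_inv_le_iff hq]
    exact hφle x
  · rw [heq]
    exact ENNReal.rpow_ne_top_of_nonneg hq'.le hφ1.ne
  · rw [heq, one_div, ENNReal.lt_rpow_inv_iff hq]
    exact hφ2

theorem weightedNorm_mono_ae {q : ℝ} (hq : 0 < q) {g g' : (Fin d → ℝ) → ℝ≥0∞}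
    (v : (Fin d → ℝ) → ℝ≥0∞) (h : ∀ᵐ x, g' x ≤ g x) :
    weightedNorm q g' v ≤ weightedNorm q g v := by
  refine ENNReal.rpow_le_rpow (lintegral_mono_ae ?_) (by positivity)
  filter_upwards [h] with x hx
  gcongr

end Extrapolation

/-! ### The extrapolation theorem. -/

theorem theorem1p3 (d : ℕ) (hd : 1 ≤ d)
    (u : (Fin d → ℝ) → ℝ≥0∞) (hu : MemA1 u)
    (p₀ q₀ t₀ : ℝ) (hp₀ : 1 ≤ p₀) (hq₀ : 0 < q₀) (ht₀ : 0 < t₀)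
    (F : Set (((Fin d → ℝ) → ℝ≥0∞) × ((Fin d → ℝ) → ℝ≥0∞)))
    (hF : ∀ gf ∈ F, AEMeasurable gf.1 volume ∧ AEMeasurable gf.2 volume) :
    -- constants that may depend on the individual weight
    ((∀ w, MemPartial₁ u p₀ t₀ w → ∃ C : ℝ≥0, ∀ gf ∈ F,
        weightedNorm q₀ gf.1 w ≤ C * weightedNorm p₀ gf.2 w) →
      ∀ p q t : ℝ, 1 < p → 0 < q → 0 < t →
        1 / p - 1 / p₀ = 1 / q - 1 / q₀ → 1 / q - 1 / q₀ = 1 / t - 1 / t₀ →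
        ∀ v, MemPartial₁ u p t v → ∃ C : ℝ≥0, ∀ gf ∈ F,
          weightedNorm q gf.1 v ≤ C * weightedNorm p gf.2 v) ∧
    -- constants that are uniform over weights whose characteristic is bounded by `K`
    ((∀ K : ℝ≥0, ∃ C : ℝ≥0, ∀ w, MemPartial₁ u p₀ t₀ w → partialConst₁ u p₀ t₀ w ≤ K → ∀ gf ∈ F,
        weightedNorm q₀ gf.1 w ≤ C * weightedNorm p₀ gf.2 w) →
      ∀ p q t : ℝ, 1 < p → 0 < q → 0 < t →
        1 / p - 1 / p₀ = 1 / q - 1 / q₀ → 1 / q - 1 / q₀ = 1 / t - 1 / t₀ →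
        ∀ K : ℝ≥0, ∃ C : ℝ≥0, ∀ v, MemPartial₁ u p t v → partialConst₁ u p t v ≤ K → ∀ gf ∈ F,
          weightedNorm q gf.1 v ≤ C * weightedNorm p gf.2 v) := by
  constructor
  · intro hyp p q t hp hq ht hpq hqt v hv
    obtain ⟨hvw, -, hvfin⟩ := (memPartial₁_iff _ _ _ _).1 hv
    obtain ⟨K₀, B, hB⟩ := exists_weight_forall_weightedNorm_le (d := d) hp hq ht hp₀ hq₀ ht₀ hpq
      (hpq.trans hqt) (partialConst₁ u p t v).toNNReal
    -- Choose pairs that violate the conclusion with constants `B n * n`. A single `w` covers them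
    -- all, and its constant `C` is exceeded by some `n`.
    by_contra! hcon
    choose gf hgf hlt using fun n : ℕ => hcon (B n * n)
    choose g hgm hgle hgfin hg using fun n => exists_le_weightedNorm_ne_top hq hvw (hlt n)
    obtain ⟨w, hw, -, hBw⟩ := hB u v hv (ENNReal.coe_toNNReal hvfin.ne).ge g (fun n => (gf n).2)
      hgm (fun n => (hF _ (hgf n)).2) hgfin
    obtain ⟨C, hC⟩ := hyp w hw
    obtain ⟨n, hn⟩ := exists_nat_ge C
    refine (hg n).not_ge ((hBw n C ((weightedNorm_mono_ae hq₀ w (hgle n)).trans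
      (hC _ (hgf n)))).trans ?_)
    rw [ENNReal.coe_mul]
    gcongr
  · intro hyp p q t hp hq ht hpq hqt K
    obtain ⟨K₀, B, hB⟩ := exists_weight_forall_weightedNorm_le (d := d) hp hq ht hp₀ hq₀ ht₀ hpq
      (hpq.trans hqt) K
    obtain ⟨C, hC⟩ := hyp K₀
    -- With uniform constants one pair at a time suffices: a constant sequence is used, at index
    -- `0`.
    refine ⟨B 0 * C, fun v hv hvK gf hgf => ?_⟩
    obtain ⟨hvw, -, -⟩ := (memPartial₁_iff _ _ _ _).1 hv
    by_contra! hlt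
    obtain ⟨g, hgm, hgle, hgfin, hg⟩ := exists_le_weightedNorm_ne_top hq hvw hlt
    obtain ⟨w, hw, hwK, hBw⟩ := hB u v hv hvK (fun _ => g) (fun _ => gf.2)
      (fun _ => hgm) (fun _ => (hF _ hgf).2) (fun _ => hgfin)
    refine hg.not_ge ((hBw 0 C ((weightedNorm_mono_ae hq₀ w hgle).trans
      (hC w hw hwK _ hgf))).trans ?_)
    rw [ENNReal.coe_mul]
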